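/- Let $\mathcal V$ be an infinite set of names. Consider the processes of the $\pi$-calculus over $\mathcal V$, taken up to $\alpha$-conversion: $$P ::= M \mid P\,|\,P' \mid \nu z.P \mid {!P},\qquad M ::= \mathbf 0 \mid \pi.P \mid M+M',\qquad \pi ::= \bar xy \mid x(z) \mid \tau \mid [x=y]\pi ,$$ with the standard early labelled transition relation $P\xrightarrow{\alpha}P'$, whose actions $\alpha$ are inputs $xy$, free outputs $\bar xy$, bound outputs $\bar x(z)$ and $\tau$; the bound name $z$ of an action $\bar x(z)$ is always taken different from the free names of the processes under consideration. Strong bisimilarity $\sim$ is the largest symmetric relation on processes such that, whenever $P\sim Q$ and $P\xrightarrow{\alpha}P'$ (with the bound name of $\alpha$, if any, not free in $P$ or $Q$), there is $Q'$ with $Q\xrightarrow{\alpha}Q'$ and $P'\sim Q'$. A process $P$ is finite if there is $n\in\mathbb N_0$ such that $P$ has no execution $P\xrightarrow{\alpha_1}\cdots\xrightarrow{\alpha_{n+1}}P'$ of length $n+1$. Then $\sim$ is an equivalence relation, and the set $\mathbf P_\sim=\{[P]_\sim : P \text{ a finite process}\}$ of $\sim$-classes of finite processes, with identity $[\mathbf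 0]_\sim$ and operation $[P]_\sim\parallel[Q]_\sim=[P\,|\,Q]_\sim$, is a (well-defined) commutative monoid that has unique decomposition. That is, for every $x\in\mathbf P_\sim$ there is exactly one finite multiset $\{p_1,\dots,p_k\}$ ($k\ge 0$) of indecomposable elements of $\mathbf P_\sim$ with $x=p_1\parallel\cdots\parallel p_k$, where $p$ is indecomposable if $p\neq[\mathbf 0]_\sim$ and $p=y\parallel z$ implies $y=[\mathbf 0]_\sim$ or $z=[\mathbf 0]_\sim$. -/

import Mathlib

namespace PiCalc

universe u

/-- The syntactic categories of the calculus: processes `P`, summations `M`, and prefixed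
processes `π.P`. -/
inductive Cat : Type
  | proc
  | summ
  | pref

/-- Terms of the π-calculus, up to α-conversion, with free names in `X`:

* `P ::= M | P ∣ P' | νz.P | !P`;
* `M ::= 0 | π.P | M + M'`;
* `π.P`, where `π ::= x̄y | x(z) | τ | [x=y]π`, is generated as
  `x̄y.P | x(z).P | τ.P | [x=y](π.P)`.

The body of a binder (`νz` or `x(z)`) is a term over `Option X`, in which `none` is the bound name
and `some x` is the name `x` of the enclosing scope. Thus terms that differ only in the choice of
their bound names are equal. See `abs` for binders with an explicit name. -/
inductive Term : Cat → Type u → Type (u + 1)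
  /-- `x̄y.P` -/
  | out {X : Type u} (x y : X) (P : Term .proc X) : Term .pref X
  /-- `x(z).P` -/
  | inp {X : Type u} (x : X) (P : Term .proc (Option X)) : Term .pref X
  /-- `τ.P` -/
  | tau {X : Type u} (P : Term .proc X) : Term .pref X
  /-- `[x=y]π.P` -/
  | mat {X : Type u} (x y : X) (G : Term .pref X) : Term .pref X
  /-- `0` -/
  | zero {X : Type u} : Term .summ X
  /-- A prefixed process as a summation. -/
  | ofPref {X : Type u} (G : Term .pref X) : Term .summ X
  /-- `M + N` -/
  | add {X : Type u} (M N : Term .summ X) : Term .summ X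
  /-- A summation as a process. -/
  | ofSumm {X : Type u} (M : Term .summ X) : Term .proc X
  /-- `P ∣ Q` -/
  | par {X : Type u} (P Q : Term .proc X) : Term .proc X
  /-- `νz.P` -/
  | res {X : Type u} (P : Term .proc (Option X)) : Term .proc X
  /-- `!P` -/
  | rep {X : Type u} (P : Term .proc X) : Term .proc X

/-- The set `Π` of processes with names in `V`. -/
abbrev Proc (V : Type u) : Type (u + 1) := Term .proc V

/-- The process `0`. -/
def nil {V : Type u} : Proc V := .ofSumm .zero

/-- Capture-avoiding renaming of the free names of a term by `f`. -/
def Term.map : {c : Cat} → {X Y : Type u} → (X → Y) → Term c X → Term c Y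
  | _, _, _, f, .out x y P => .out (f x) (f y) (P.map f)
  | _, _, _, f, .inp x P => .inp (f x) (P.map (Option.map f))
  | _, _, _, f, .tau P => .tau (P.map f)
  | _, _, _, f, .mat x y G => .mat (f x) (f y) (G.map f)
  | _, _, _, _, .zero => .zero
  | _, _, _, f, .ofPref G => .ofPref (G.map f)
  | _, _, _, f, .add M N => .add (M.map f) (N.map f)
  | _, _, _, f, .ofSumm M => .ofSumm (M.map f)
  | _, _, _, f, .par P Q => .par (P.map f) (Q.map f)
  | _, _, _, f, .res P => .res (P.map (Option.map f))
  | _, _, _, f, .rep P => .rep (P.map f)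

/-- The set `fn(P)` of free names of a term. -/
def Term.fn : {c : Cat} → {X : Type u} → Term c X → Set X
  | _, _, .out x y P => {x, y} ∪ P.fn
  | _, _, .inp x P => {x} ∪ {a | some a ∈ P.fn}
  | _, _, .tau P => P.fn
  | _, _, .mat x y G => {x, y} ∪ G.fn
  | _, _, .zero => ∅
  | _, _, .ofPref G => G.fn
  | _, _, .add M N => M.fn ∪ N.fn
  | _, _, .ofSumm M => M.fn
  | _, _, .par P Q => P.fn ∪ Q.fn
  | _, _, .res P => {a | some a ∈ P.fn}
  | _, _, .rep P => P.fn

open Classical in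
/-- Abstraction of the name `z` in `P`: the process `νz.P` is `.res (abs z P)`, and the prefixed
process `x(z).P` is `.inp x (abs z P)`. -/
noncomputable def abs {V : Type u} (z : V) (P : Proc V) : Proc (Option V) :=
  P.map fun x => if x = z then none else some x

open Classical in
/-- The capture-avoiding substitution `P{y/z}`. -/
noncomputable def subst {V : Type u} (P : Proc V) (y z : V) : Proc V :=
  P.map fun x => if x = z then y else x

/-- The set `A_τ` of actions: input `xy`, free output `x̄y`, bound output `x̄(z)`, and `τ`. -/
inductive Act (V : Type u) : Type u
  | inp (x y : V)
  | out (x y : V)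
  | bout (x z : V)
  | tau

/-- The set `n(α)` of names of an action. -/
def Act.names {V : Type u} : Act V → Set V
  | .inp x y => {x, y}
  | .out x y => {x, y}
  | .bout x z => {x, z}
  | .tau => ∅

/-- The set `bn(α)` of bound names of an action. -/
def Act.bn {V : Type u} : Act V → Set V
  | .bout _ z => {z}
  | _ => ∅

/-- The (early) transition relation `P —α→ P'` of the π-calculus. Terms are identified up to
α-conversion, and the bound name of an action is always taken different from the free names of the
process that performs it; rules `sumL` and `sumR` record this convention as a side condition, and
the other rules preserve it. -/
inductive Step {V : Type u} : {c : Cat} → Term c V → Act V → Proc V → Prop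
  | out (x y : V) (P : Proc V) : Step (.out x y P) (.out x y) P
  | inp (x y z : V) (P : Proc V) : Step (.inp x (abs z P)) (.inp x y) (subst P y z)
  | tau (P : Proc V) : Step (.tau P) .tau P
  | mat (x : V) {G : Term .pref V} {α : Act V} {P' : Proc V} :
      Step G α P' → Step (.mat x x G) α P'
  /-- A prefixed process, seen as a summation, has the same transitions. -/
  | ofPref {G : Term .pref V} {α : Act V} {P' : Proc V} : Step G α P' → Step (.ofPref G) α P'
  | sumL {M N : Term .summ V} {α : Act V} {P' : Proc V} :
      Step M α P' → Disjoint α.bn N.fn → Step (.add M N) α P'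
  | sumR {M N : Term .summ V} {α : Act V} {P' : Proc V} :
      Step N α P' → Disjoint α.bn M.fn → Step (.add M N) α P'
  /-- A summation, seen as a process, has the same transitions. -/
  | ofSumm {M : Term .summ V} {α : Act V} {P' : Proc V} : Step M α P' → Step (.ofSumm M) α P'
  | parL {P P' Q : Proc V} {α : Act V} :
      Step P α P' → Disjoint α.bn Q.fn → Step (.par P Q) α (.par P' Q)
  | parR {P Q Q' : Proc V} {α : Act V} :
      Step Q α Q' → Disjoint α.bn P.fn → Step (.par P Q) α (.par P Q')
  | commL {P P' Q Q' : Proc V} {x y : V} :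
      Step P (.out x y) P' → Step Q (.inp x y) Q' → Step (.par P Q) .tau (.par P' Q')
  | commR {P P' Q Q' : Proc V} {x y : V} :
      Step P (.inp x y) P' → Step Q (.out x y) Q' → Step (.par P Q) .tau (.par P' Q')
  | closeL {P P' Q Q' : Proc V} {x z : V} :
      Step P (.bout x z) P' → Step Q (.inp x z) Q' → z ∉ Q.fn →
      Step (.par P Q) .tau (.res (abs z (.par P' Q')))
  | closeR {P P' Q Q' : Proc V} {x z : V} :
      Step P (.inp x z) P' → Step Q (.bout x z) Q' → z ∉ P.fn →
      Step (.par P Q) .tau (.res (abs z (.par P' Q')))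
  | res {P P' : Proc V} {α : Act V} {z : V} :
      Step P α P' → z ∉ α.names → Step (.res (abs z P)) α (.res (abs z P'))
  | opn {P P' : Proc V} {x z : V} :
      Step P (.out x z) P' → z ≠ x → Step (.res (abs z P)) (.bout x z) P'
  | repAct {P P' : Proc V} {α : Act V} :
      Step P α P' → Step (.rep P) α (.par P' (.rep P))
  | repComm {P P' P'' : Proc V} {x y : V} :
      Step P (.out x y) P' → Step P (.inp x y) P'' →
      Step (.rep P) .tau (.par (.par P' P'') (.rep P))
  | repClose {P P' P'' : Proc V} {x z : V} :
      Step P (.bout x z) P' → Step P (.inp x z) P'' → z ∉ P.fn →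
      Step (.rep P) .tau (.par (.res (abs z (.par P' P''))) (.rep P))

/-- `R` is a strong bisimulation: it is symmetric, and whenever `R P Q` and `P —α→ P'` then
`Q —α→ Q'` and `R P' Q'` for some `Q'`. By the convention on bound names, the bound name of `α` is
chosen different from the free names of `Q` (and those of `P`). -/
def IsBisimulation {V : Type u} (R : Proc V → Proc V → Prop) : Prop :=
  (∀ P Q, R P Q → R Q P) ∧
  ∀ P Q, R P Q → ∀ (α : Act V) (P' : Proc V), Disjoint α.bn (P.fn ∪ Q.fn) → Step P α P' →
    ∃ Q', Step Q α Q' ∧ R P' Q'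

/-- Strong bisimilarity `∼`, the largest strong bisimulation. -/
def Bisim {V : Type u} (P Q : Proc V) : Prop :=
  ∃ R : Proc V → Proc V → Prop, IsBisimulation R ∧ R P Q

/-- `Exec P ω P'`: the process `P` can perform the sequence of actions `ω` and become `P'`. -/
inductive Exec {V : Type u} : Proc V → List (Act V) → Proc V → Prop
  | refl (P : Proc V) : Exec P [] P
  | step {P P' P'' : Proc V} {α : Act V} {ω : List (Act V)} :
      Step P α P' → Exec P' ω P'' → Exec P (α :: ω) P''

/-- A process is finite if there is a bound on the length of its executions. -/
def IsFinite {V : Type u} (P : Proc V) : Prop :=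
  ∃ n : ℕ, ¬ ∃ (ω : List (Act V)) (P' : Proc V), ω.length = n + 1 ∧ Exec P ω P'

/-- The class `[P]` of the processes that are strongly bisimilar to `P`. -/
def bisimClass {V : Type u} (P : Proc V) : Set (Proc V) := {P' | Bisim P' P}

/-- The set of the classes `[P]` of finite processes `P`. -/
def FinClass (V : Type u) : Type (u + 1) :=
  {C : Set (Proc V) // ∃ P : Proc V, IsFinite P ∧ C = bisimClass P}

/-- The class of a finite process, as an element of `FinClass V`. -/
def FinClass.mk {V : Type u} (P : Proc V) (hP : IsFinite P) : FinClass V :=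
  ⟨bisimClass P, P, hP, rfl⟩

/-- `p` is indecomposable: `p ≠ e`, and `p = xy` implies `x = e` or `y = e`. -/
def Indecomposable {M : Type u} [CommMonoid M] (p : M) : Prop :=
  p ≠ 1 ∧ ∀ x y : M, p = x * y → x = 1 ∨ y = 1

/-- `d` is a decomposition of `x`: a finite multiset of indecomposable elements with
composition `x`. -/
def IsDecomposition {M : Type u} [CommMonoid M] (d : Multiset M) (x : M) : Prop :=
  (∀ p ∈ d, Indecomposable p) ∧ d.prod = x

/-- Every element of `M` has one and only one decomposition. -/
def HasUniqueDecomposition (M : Type u) [CommMonoid M] : Prop :=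
  ∀ x : M, ∃! d : Multiset M, IsDecomposition d x

end PiCalc

/-!
The proof rests on a relation of *reduction* between classes of finite processes. A process `P`
reduces to `P'` if `P —α→ P'` by an action without a bound name and the depth of `P'` (the greatest
length of its executions) is exactly one less than that of `P`; and it reduces to `νz.P'` if
`P —x̄(z)→ P'` (`Red`). The depth is additive over parallel composition. A communication inside
`P ∣ Q` takes a step of both components, and hence lowers the depth by at least two; so it is not a
reduction. This disposes of the transitions that can lead from `P ∣ Q` to a process `νz(P' ∣ Q')`
that is no longer a parallel composition. Restricting an extruded name again makes reduction
independent of the choice of that name: by scope extrusion, `νz(P' ∣ Q) ∼ νz.P' ∣ Q` for `z` not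
free in `Q`. Thus a parallel composition reduces precisely by the reduction of one component, and
only `[0]` is irreducible (`FinClass.isReduction`).

A commutative monoid with such a relation has unique decomposition
(`IsReduction.hasUniqueDecomposition`). Let `A` and `B` be distinct decompositions of an element of
minimal depth, and let `p` be a component of maximal depth whose multiplicity differs, say greater
in `A` (`IsReduction.false_of_count_lt`). The decompositions of the reducts of the element are
unique, so every reduction of a component of `A` is matched by one of `B`, and conversely. For a
component `q` of greater depth than `p`, the matching reduction is one of `q` too, and comparison of
the multiplicities of `p` gives reducts of `q` with ever more components `p`: impossible. So no
component is deeper than `p`. Reduction of a component other than `p` in `A` would keep the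
surplus of `p`; so `A` is a power of `p`. If `A = {p}`, the element is indecomposable; otherwise `B`
contains `p`, and its reduction in `B` cannot be matched in `A`.

That bisimilarity is an equivalence relation, a congruence for parallel composition and
restriction, and satisfies the monoid laws and scope extrusion is proved in one stroke: the relation
`Struct` generated by all these laws and bisimilarity is a bisimulation (`isBisimulation_struct`).
Throughout, transitions are equivariant under permutations of the names (`Step.map`), which allows
bound names to be chosen outside any finite set (`Step.parStep`, `Step.resStep`).
-/

namespace PiCalc

universe u

variable {V : Type u}

/-! ### Renaming and free names -/

namespace Term

theorem map_map {c : Cat} {X : Type u} (P : Term c X) :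
    ∀ {Y Z : Type u} (f : X → Y) (g : Y → Z), (P.map f).map g = P.map (g ∘ f) := by
  induction P <;> intro Y Z f g <;> simp [Term.map, *]

theorem fn_map {c : Cat} {X : Type u} (P : Term c X) :
    ∀ {Y : Type u} (f : X → Y), (P.map f).fn = f '' P.fn := by
  induction P <;> intro Y f
  case inp ih => ext a; simp [Term.map, Term.fn, ih, Set.image_insert_eq]
  case res ih => ext a; simp [Term.map, Term.fn, ih]
  all_goals simp [Term.map, Term.fn, Set.image_union, Set.image_insert_eq, *]

theorem map_congr {c : Cat} {X : Type u} (P : Term c X) :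
    ∀ {Y : Type u} {f g : X → Y}, (∀ a ∈ P.fn, f a = g a) → P.map f = P.map g := by
  have lift {X Y : Type u} {f g : X → Y} {s : Set (Option X)}
      (h : ∀ a, some a ∈ s → f a = g a) : ∀ a ∈ s, Option.map f a = Option.map g a := by
    rintro (_ | a) ha
    · rfl
    · simp [h a ha]
  induction P <;> intro Y f g h <;> simp only [Term.map, Term.fn, Set.mem_union, Set.mem_insert_iff,
    Set.mem_singleton_iff, Set.mem_ofPred_eq] at h ⊢
  case out ih => rw [h _ (by simp), h _ (by simp), ih fun a ha => h a (by simp [ha])]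
  case inp ih => rw [h _ (by simp), ih (lift fun a ha => h a (by simp [ha]))]
  case tau ih => rw [ih h]
  case mat ih => rw [h _ (by simp), h _ (by simp), ih fun a ha => h a (by simp [ha])]
  case ofPref ih => rw [ih h]
  case add ih₁ ih₂ => rw [ih₁ fun a ha => h a (by simp [ha]), ih₂ fun a ha => h a (by simp [ha])]
  case ofSumm ih => rw [ih h]
  case par ih₁ ih₂ => rw [ih₁ fun a ha => h a (by simp [ha]), ih₂ fun a ha => h a (by simp [ha])]
  case res ih => rw [ih (lift h)]
  case rep ih => rw [ih h]

theorem map_id {c : Cat} {X : Type u} (P : Term c X) : P.map id = P := by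
  induction P <;> simp [Term.map, *]

theorem finite_fn {c : Cat} {X : Type u} (P : Term c X) : P.fn.Finite := by
  have lift {X : Type u} {s : Set (Option X)} (h : s.Finite) : {a | some a ∈ s}.Finite :=
    h.preimage (Option.some_injective _).injOn
  induction P <;> simp_all [Term.fn]

/-- A renaming that fixes the free names of a term fixes the term. -/
theorem map_eq_self {c : Cat} {X : Type u} (P : Term c X) {f : X → X}
    (h : ∀ a ∈ P.fn, f a = a) : P.map f = P :=
  (P.map_congr h).trans P.map_id

end Term

/-- The instance of the body `B` of a binder in which the bound name is `z`. -/
def inst {X : Type u} (B : Proc (Option X)) (z : X) : Proc X :=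
  B.map fun o => o.getD z

/-- Substitution is instantiation of an abstraction. -/
theorem inst_abs (P : Proc V) (y z : V) : inst (abs z P) y = subst P y z := by
  classical
  simp only [inst, abs, subst, Term.map_map]
  refine P.map_congr fun a _ => ?_
  by_cases h : a = z <;> simp [h]

theorem inst_abs_self (P : Proc V) (z : V) : inst (abs z P) z = P := by
  classical
  simp only [inst, abs, Term.map_map]
  refine P.map_eq_self fun a _ => ?_
  by_cases h : a = z <;> simp [h]

theorem abs_inst {B : Proc (Option V)} {z : V} (h : some z ∉ B.fn) : abs z (inst B z) = B := by
  classical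
  simp only [inst, abs, Term.map_map]
  refine B.map_eq_self ?_
  rintro (_ | a) ha
  · simp
  · have : a ≠ z := by rintro rfl; exact h ha
    simp [this]

theorem some_mem_fn_abs {P : Proc V} {z a : V} : some a ∈ (abs z P).fn ↔ a ∈ P.fn ∧ a ≠ z := by
  classical
  simp only [abs, Term.fn_map, Set.mem_image]
  constructor
  · rintro ⟨b, hb, h⟩
    by_cases e : b = z
    · simp [e] at h
    · simp only [e, if_false, Option.some.injEq] at h
      exact h ▸ ⟨hb, e⟩
  · rintro ⟨h, e⟩
    exact ⟨a, h, by simp [e]⟩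

theorem mem_fn_res_abs {P : Proc V} {z a : V} :
    a ∈ (Term.res (abs z P)).fn ↔ a ∈ P.fn ∧ a ≠ z :=
  some_mem_fn_abs

theorem mem_fn_inst {B : Proc (Option V)} {z a : V} (h : a ∈ (inst B z).fn) :
    some a ∈ B.fn ∨ a = z := by
  simp only [inst, Term.fn_map, Set.mem_image] at h
  obtain ⟨_ | b, hb, rfl⟩ := h
  · exact .inr rfl
  · exact .inl hb

theorem mem_fn_inst_of_some {B : Proc (Option V)} {z a : V} (h : some a ∈ B.fn) :
    a ∈ (inst B z).fn := by
  simp only [inst, Term.fn_map, Set.mem_image]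
  exact ⟨some a, h, rfl⟩

/-- Abstraction of a name that is not free is weakening. -/
theorem abs_of_notMem {P : Proc V} {z : V} (h : z ∉ P.fn) : abs z P = P.map some := by
  classical
  refine P.map_congr fun a ha => ?_
  have : a ≠ z := by rintro rfl; exact h ha
  simp [this]

theorem inst_map_some (P : Proc V) (z : V) : inst (P.map some) z = P := by
  simp only [inst, Term.map_map]
  exact P.map_eq_self fun a _ => rfl

theorem abs_map {f : V → V} (hf : Function.Injective f) (P : Proc V) (z : V) :
    (abs z P).map (Option.map f) = abs (f z) (P.map f) := by
  classical
  simp only [abs, Term.map_map]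
  refine P.map_congr fun a _ => ?_
  by_cases h : a = z <;> simp [h, hf.eq_iff]

theorem inst_map (B : Proc (Option V)) (f : V → V) (z : V) :
    (inst B z).map f = inst (B.map (Option.map f)) (f z) := by
  simp only [inst, Term.map_map]
  refine B.map_congr ?_
  rintro (_ | a) _ <;> rfl

theorem subst_map {f : V → V} (hf : Function.Injective f) (P : Proc V) (y z : V) :
    (subst P y z).map f = subst (P.map f) (f y) (f z) := by
  rw [← inst_abs, ← inst_abs, inst_map, abs_map hf]

/-- Abstraction does not depend on the choice of the name, up to `α`-conversion. -/
theorem abs_swap [DecidableEq V] {P : Proc V} {z w : V} (h : w = z ∨ w ∉ P.fn) :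
    abs w (P.map (Equiv.swap z w)) = abs z P := by
  simp only [abs, Term.map_map]
  refine P.map_congr fun a ha => ?_
  rcases h with rfl | h
  · simp
  · have hw : a ≠ w := by rintro rfl; exact h ha
    by_cases hz : a = z
    · simp [hz]
    · simp [Equiv.swap_apply_of_ne_of_ne hz hw, hw, hz]

/-! ### Transitions -/

namespace Act

/-- Renaming of the names of an action. -/
def map (f : V → V) : Act V → Act V
  | .inp x y => .inp (f x) (f y)
  | .out x y => .out (f x) (f y)
  | .bout x z => .bout (f x) (f z)
  | .tau => .tau

theorem names_map (f : V → V) (α : Act V) : (α.map f).names = f '' α.names := by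
  cases α <;> simp [map, names, Set.image_insert_eq]

theorem bn_map (f : V → V) (α : Act V) : (α.map f).bn = f '' α.bn := by
  cases α <;> simp [map, bn]

theorem bn_subset_names (α : Act V) : α.bn ⊆ α.names := by
  cases α <;> simp [bn, names]

theorem finite_names (α : Act V) : α.names.Finite := by
  cases α <;> simp [names]

theorem map_eq_self {f : V → V} {α : Act V} (h : ∀ a ∈ α.names, f a = a) : α.map f = α := by
  cases α <;> simp_all [map, names]

end Act

namespace Step

/-- Transitions are preserved by permutations of the names. -/
theorem map {c : Cat} {P : Term c V} {α : Act V} {P' : Proc V} (h : Step P α P')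
    (σ : Equiv.Perm V) : Step (P.map σ) (α.map σ) (P'.map σ) := by
  have hσ := σ.injective
  have disj {s t : Set V} (h : Disjoint s t) : Disjoint (σ '' s) (σ '' t) :=
    (Set.disjoint_image_iff hσ).2 h
  have nm {s : Set V} {a : V} (h : a ∉ s) : σ a ∉ σ '' s := by
    simpa [hσ.mem_set_image] using h
  induction h with
  | inp x y z P => simp only [Term.map, abs_map hσ, subst_map hσ]; exact .inp ..
  | sumL _ hd ih => exact .sumL ih (by rw [Act.bn_map, Term.fn_map]; exact disj hd)
  | sumR _ hd ih => exact .sumR ih (by rw [Act.bn_map, Term.fn_map]; exact disj hd)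
  | parL _ hd ih => exact .parL ih (by rw [Act.bn_map, Term.fn_map]; exact disj hd)
  | parR _ hd ih => exact .parR ih (by rw [Act.bn_map, Term.fn_map]; exact disj hd)
  | closeL _ _ hz ih₁ ih₂ =>
    simp only [Term.map, abs_map hσ]
    exact .closeL ih₁ ih₂ (by rw [Term.fn_map]; exact nm hz)
  | closeR _ _ hz ih₁ ih₂ =>
    simp only [Term.map, abs_map hσ]
    exact .closeR ih₁ ih₂ (by rw [Term.fn_map]; exact nm hz)
  | res _ hz ih =>
    simp only [Term.map, abs_map hσ]
    exact .res ih (by rw [Act.names_map]; exact nm hz)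
  | opn _ hz ih =>
    simp only [Term.map, abs_map hσ]
    exact .opn ih (hσ.ne hz)
  | repClose _ _ hz ih₁ ih₂ =>
    simp only [Term.map, abs_map hσ]
    exact .repClose ih₁ ih₂ (by rw [Term.fn_map]; exact nm hz)
  | out => exact .out ..
  | tau => exact .tau ..
  | mat _ _ ih => exact .mat _ ih
  | ofPref _ ih => exact .ofPref ih
  | ofSumm _ ih => exact .ofSumm ih
  | commL _ _ ih₁ ih₂ => exact .commL ih₁ ih₂
  | commR _ _ ih₁ ih₂ => exact .commR ih₁ ih₂
  | repAct _ ih => exact .repAct ih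
  | repComm _ _ ih₁ ih₂ => exact .repComm ih₁ ih₂

end Step

/-- The relation between the names of an action and the free names `s` of a process that performs
it: only the object of an input may be arbitrary, and a bound name is not in `s`. -/
def Act.NamesIn (s : Set V) : Act V → Prop
  | .inp x _ => x ∈ s
  | .out x y => x ∈ s ∧ y ∈ s
  | .bout x z => x ∈ s ∧ z ∉ s
  | .tau => True

namespace Step

/-- A prefixed process has no bound output: these come from restrictions only. -/
theorem bn_eq_empty_of_pref {G : Term .pref V} {α : Act V} {P' : Proc V} (h : Step G α P') :
    α.bn = ∅ := by
  generalize hc : Cat.pref = c at G h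
  induction h <;> first | rfl | cases hc
  case mat ih => exact ih rfl

theorem namesIn {c : Cat} {P : Term c V} {α : Act V} {P' : Proc V} (h : Step P α P') :
    α.NamesIn P.fn := by
  induction h with
  | inp | out => simp [Act.NamesIn, Term.fn]
  | tau | commL | commR | closeL | closeR | repComm | repClose => trivial
  | ofPref _ ih | ofSumm _ ih | repAct _ ih => exact ih
  | @mat _ _ α _ h ih =>
    have := h.bn_eq_empty_of_pref
    cases α <;> simp_all [Act.NamesIn, Term.fn, Act.bn]
  | @sumL _ _ α _ _ hd ih | @sumR _ _ α _ _ hd ih | @parL _ _ _ α _ hd ih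
  | @parR _ _ _ α _ hd ih => cases α <;> simp_all [Act.NamesIn, Term.fn, Act.bn]
  | @res P P' α z _ hz ih =>
    cases α <;> simp_all [Act.NamesIn, mem_fn_res_abs, Act.names, eq_comm]
  | opn _ hz ih => simp_all [Act.NamesIn, mem_fn_res_abs, eq_comm]

/-- A transition introduces no free names besides those of its action. -/
theorem fn_subset {c : Cat} {P : Term c V} {α : Act V} {P' : Proc V} (h : Step P α P') :
    P'.fn ⊆ P.fn ∪ α.names := by
  -- The names in a free output are free in the sender, and so is the subject of a bound output.
  have comm {P Q P' Q' : Proc V} {x y : V} (h : Step P (.out x y) P')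
      (h₁ : P'.fn ⊆ P.fn ∪ {x, y}) (h₂ : Q'.fn ⊆ Q.fn ∪ {x, y}) :
      P'.fn ∪ Q'.fn ⊆ P.fn ∪ Q.fn := by
    have ⟨hx, hy⟩ := h.namesIn
    intro a ha
    have h₁ := @h₁ a
    have h₂ := @h₂ a
    simp only [Set.mem_union, Set.mem_insert_iff, Set.mem_singleton_iff] at *
    grind
  have close {P Q P' Q' : Proc V} {x z : V} (h : Step P (.bout x z) P')
      (h₁ : P'.fn ⊆ P.fn ∪ {x, z}) (h₂ : Q'.fn ⊆ Q.fn ∪ {x, z}) {a : V}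
      (ha : a ∈ P'.fn ∪ Q'.fn ∧ a ≠ z) : a ∈ P.fn ∪ Q.fn := by
    have ⟨hx, _⟩ := h.namesIn
    have h₁ := @h₁ a
    have h₂ := @h₂ a
    simp only [Set.mem_union, Set.mem_insert_iff, Set.mem_singleton_iff] at *
    grind
  induction h with
  | inp x y z P =>
    intro a ha
    rw [← inst_abs] at ha
    rcases mem_fn_inst ha with h | h <;> simp [Term.fn, Act.names, h]
  | out | tau => intro a; simp +contextual [Term.fn]
  | mat _ _ ih => intro a ha; have := ih ha; simp only [Term.fn, Set.mem_union] at *; tauto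
  | ofPref _ ih | ofSumm _ ih => exact ih
  | sumL _ _ ih | sumR _ _ ih | parL _ _ ih | parR _ _ ih | repAct _ ih =>
    intro a ha
    have := @ih a
    simp only [Term.fn, Set.mem_union] at *; tauto
  | commL h₁ _ ih₁ ih₂ =>
    exact (comm h₁ ih₁ ih₂).trans Set.subset_union_left
  | commR _ h₂ ih₁ ih₂ =>
    intro a ha
    have := comm h₂ ih₂ ih₁ (Or.symm ha)
    exact .inl (Or.symm this)
  | closeL h₁ _ _ ih₁ ih₂ =>
    intro a ha
    rw [mem_fn_res_abs] at ha
    exact .inl (close h₁ ih₁ ih₂ ha)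
  | closeR _ h₂ _ ih₁ ih₂ =>
    intro a ha
    rw [mem_fn_res_abs] at ha
    exact .inl (Or.symm (close h₂ ih₂ ih₁ ⟨Or.symm ha.1, ha.2⟩))
  | res _ hz ih =>
    intro a ha
    rw [Set.mem_union, mem_fn_res_abs] at *
    have := @ih a
    simp only [Set.mem_union] at this
    tauto
  | opn _ hz ih =>
    intro a ha
    rw [Set.mem_union, mem_fn_res_abs]
    have := @ih a ha
    simp only [Act.names, Set.mem_union, Set.mem_insert_iff, Set.mem_singleton_iff] at *
    tauto
  | repComm h₁ _ ih₁ ih₂ =>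
    rintro a (ha | ha)
    · exact .inl ((comm h₁ ih₁ ih₂ ha).elim id id)
    · exact .inl ha
  | repClose h₁ _ _ ih₁ ih₂ =>
    rintro a (ha | ha)
    · rw [mem_fn_res_abs] at ha
      exact .inl ((close h₁ ih₁ ih₂ ha).elim id id)
    · exact .inl ha

theorem inp_mem {c : Cat} {P : Term c V} {x y : V} {P' : Proc V} (h : Step P (.inp x y) P') :
    x ∈ P.fn := h.namesIn

theorem out_mem {c : Cat} {P : Term c V} {x y : V} {P' : Proc V} (h : Step P (.out x y) P') :
    x ∈ P.fn ∧ y ∈ P.fn := h.namesIn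

theorem bout_mem {c : Cat} {P : Term c V} {x z : V} {P' : Proc V} (h : Step P (.bout x z) P') :
    x ∈ P.fn ∧ z ∉ P.fn := h.namesIn

theorem notMem_of_notMem {c : Cat} {P : Term c V} {α : Act V} {P' : Proc V} (h : Step P α P')
    {z : V} (hP : z ∉ P.fn) (hα : z ∉ α.names) : z ∉ P'.fn :=
  fun hz => (h.fn_subset hz).elim hP hα

end Step

/-! ### Choice of bound names -/

theorem exists_fresh [Infinite V] {F : Set V} (hF : F.Finite) : ∃ z, z ∉ F :=
  hF.exists_notMem

theorem Term.map_swap [DecidableEq V] {c : Cat} {P : Term c V} {z w : V} (hz : z ∉ P.fn)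
    (hw : w ∉ P.fn) : P.map (Equiv.swap z w) = P :=
  P.map_eq_self fun _ ha => Equiv.swap_apply_of_ne_of_ne
    (fun h => hz (h ▸ ha)) (fun h => hw (h ▸ ha))

theorem Act.map_swap [DecidableEq V] {α : Act V} {z w : V} (hz : z ∉ α.names)
    (hw : w ∉ α.names) : α.map (Equiv.swap z w) = α :=
  α.map_eq_self fun _ ha => Equiv.swap_apply_of_ne_of_ne
    (fun h => hz (h ▸ ha)) (fun h => hw (h ▸ ha))

/-- Two instances of a body by fresh names differ by the transposition of these names. -/
theorem inst_map_swap [DecidableEq V] {B : Proc (Option V)} {z w : V} (hz : some z ∉ B.fn)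
    (hw : some w ∉ B.fn) : (inst B z).map (Equiv.swap z w) = inst B w := by
  rw [inst_map, Equiv.swap_apply_left]
  congr 1
  refine B.map_eq_self ?_
  rintro (_ | a) ha
  · rfl
  · have h₁ : a ≠ z := by rintro rfl; exact hz ha
    have h₂ : a ≠ w := by rintro rfl; exact hw ha
    simp [Equiv.swap_apply_of_ne_of_ne h₁ h₂]

/-- The bound name of a bound output can be replaced by any name that is not free in the
process. -/
theorem Step.bout_swap [DecidableEq V] {c : Cat} {P : Term c V} {x z w : V} {P' : Proc V}
    (h : Step P (.bout x z) P') (hw : w ∉ P.fn) :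
    Step P (.bout x w) (P'.map (Equiv.swap z w)) := by
  have ⟨hx, hz⟩ := h.bout_mem
  have h' := h.map (Equiv.swap z w)
  rw [Term.map_swap hz hw, Act.map, Equiv.swap_apply_left, Equiv.swap_apply_of_ne_of_ne] at h'
  · exact h'
  · rintro rfl; exact hz hx
  · rintro rfl; exact hw hx

/-- A fresh name received can be replaced by any other fresh name. -/
theorem Step.inp_swap [DecidableEq V] {c : Cat} {P : Term c V} {x z w : V} {P' : Proc V}
    (h : Step P (.inp x z) P') (hz : z ∉ P.fn) (hw : w ∉ P.fn) :
    Step P (.inp x w) (P'.map (Equiv.swap z w)) := by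
  have hx := h.inp_mem
  have h' := h.map (Equiv.swap z w)
  rw [Term.map_swap hz hw, Act.map, Equiv.swap_apply_left, Equiv.swap_apply_of_ne_of_ne] at h'
  · exact h'
  · rintro rfl; exact hz hx
  · rintro rfl; exact hw hx

/-- The transitions of `P ∣ Q`, where the name extruded by a communication between `P` and `Q` is
not in `F`. -/
inductive ParStep (F : Set V) (P Q : Proc V) : Act V → Proc V → Prop
  | left {α : Act V} {P' : Proc V} (h : Step P α P') (hd : Disjoint α.bn Q.fn) :
      ParStep F P Q α (.par P' Q)
  | right {α : Act V} {Q' : Proc V} (h : Step Q α Q') (hd : Disjoint α.bn P.fn) :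
      ParStep F P Q α (.par P Q')
  | commL {x y : V} {P' Q' : Proc V} (hP : Step P (.out x y) P') (hQ : Step Q (.inp x y) Q') :
      ParStep F P Q .tau (.par P' Q')
  | commR {x y : V} {P' Q' : Proc V} (hP : Step P (.inp x y) P') (hQ : Step Q (.out x y) Q') :
      ParStep F P Q .tau (.par P' Q')
  | closeL {x z : V} {P' Q' : Proc V} (hP : Step P (.bout x z) P') (hQ : Step Q (.inp x z) Q')
      (hz : z ∉ F) (hzP : z ∉ P.fn) (hzQ : z ∉ Q.fn) :
      ParStep F P Q .tau (.res (abs z (.par P' Q')))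
  | closeR {x z : V} {P' Q' : Proc V} (hP : Step P (.inp x z) P') (hQ : Step Q (.bout x z) Q')
      (hz : z ∉ F) (hzP : z ∉ P.fn) (hzQ : z ∉ Q.fn) :
      ParStep F P Q .tau (.res (abs z (.par P' Q')))

theorem Step.parStep [Infinite V] {P Q R : Proc V} {α : Act V} (h : Step (.par P Q) α R)
    {F : Set V} (hF : F.Finite) : ParStep F P Q α R := by
  classical
  cases h with
  | parL h hd => exact .left h hd
  | parR h hd => exact .right h hd
  | commL h₁ h₂ => exact .commL h₁ h₂
  | commR h₁ h₂ => exact .commR h₁ h₂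
  | @closeL _ P' _ Q' x z h₁ h₂ hz =>
    obtain ⟨w, hw⟩ := exists_fresh (hF.union (P.finite_fn.union (Q.finite_fn.union
      (P'.par Q').finite_fn)))
    simp only [Set.mem_union, not_or] at hw
    obtain ⟨hwF, hwP, hwQ, hw⟩ := hw
    rw [← abs_swap (.inr hw)]
    exact .closeL (h₁.bout_swap hwP) (h₂.inp_swap hz hwQ) hwF hwP hwQ
  | @closeR _ P' _ Q' x z h₁ h₂ hz =>
    obtain ⟨w, hw⟩ := exists_fresh (hF.union (P.finite_fn.union (Q.finite_fn.union
      (P'.par Q').finite_fn)))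
    simp only [Set.mem_union, not_or] at hw
    obtain ⟨hwF, hwP, hwQ, hw⟩ := hw
    rw [← abs_swap (.inr hw)]
    exact .closeR (h₁.inp_swap hz hwP) (h₂.bout_swap hwQ) hwF hwP hwQ

/-- The transitions of `νB`, where the restricted name is not in `F`, unless it is extruded. -/
inductive ResStep (F : Set V) (B : Proc (Option V)) : Act V → Proc V → Prop
  | res {α : Act V} {z : V} {P' : Proc V} (h : Step (inst B z) α P') (hz : z ∉ α.names)
      (hF : z ∉ F) (hB : some z ∉ B.fn) : ResStep F B α (.res (abs z P'))
  | opn {x z : V} {P' : Proc V} (h : Step (inst B z) (.out x z) P') (hz : z ≠ x)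
      (hB : some z ∉ B.fn) : ResStep F B (.bout x z) P'

theorem Step.resStep [Infinite V] {B : Proc (Option V)} {R : Proc V} {α : Act V}
    (h : Step (.res B) α R) {F : Set V} (hF : F.Finite) : ResStep F B α R := by
  classical
  cases h with
  | @res P P' _ z h hz =>
    obtain ⟨w, hw⟩ := exists_fresh (hF.union (P.finite_fn.union (P'.finite_fn.union
      α.finite_names)))
    simp only [Set.mem_union, not_or] at hw
    obtain ⟨hwF, hwP, hwP', hwα⟩ := hw
    rw [← abs_swap (.inr hwP'), ← abs_swap (.inr hwP)]
    refine .res ?_ hwα hwF ?_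
    · rw [inst_abs_self]
      simpa only [Act.map_swap hz hwα] using h.map (Equiv.swap z w)
    · simp [some_mem_fn_abs]
  | @opn P P' x z h hz =>
    exact .opn (by rwa [inst_abs_self]) hz (by simp [some_mem_fn_abs])

/-- The rule for `ν` in terms of the body of the binder. -/
theorem Step.res_of_inst {B : Proc (Option V)} {z : V} {α : Act V} {P' : Proc V}
    (h : Step (inst B z) α P') (hz : z ∉ α.names) (hB : some z ∉ B.fn) :
    Step (.res B) α (.res (abs z P')) := by
  have := Step.res h hz
  rwa [abs_inst hB] at this

/-- The rule for scope opening in terms of the body of the binder. -/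
theorem Step.opn_of_inst {B : Proc (Option V)} {x z : V} {P' : Proc V}
    (h : Step (inst B z) (.out x z) P') (hz : z ≠ x) (hB : some z ∉ B.fn) :
    Step (.res B) (.bout x z) P' := by
  have := Step.opn h hz
  rwa [abs_inst hB] at this

theorem abs_par (z : V) (P Q : Proc V) : abs z (.par P Q) = .par (abs z P) (abs z Q) := rfl

theorem abs_par_right {z : V} {Q : Proc V} (P : Proc V) (h : z ∉ Q.fn) :
    abs z (.par P Q) = .par (abs z P) (Q.map some) := by
  rw [abs_par, abs_of_notMem h]

theorem inst_par (B C : Proc (Option V)) (z : V) :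
    inst (.par B C) z = .par (inst B z) (inst C z) := rfl

theorem not_step_nil {α : Act V} {P : Proc V} : ¬ Step nil α P := by
  intro h
  cases h with | ofSumm h => cases h

/-! ### Bisimilarity is a congruence -/

theorem isBisimulation_bisim : IsBisimulation (Bisim (V := V)) := by
  refine ⟨fun P Q ⟨R, hR, h⟩ => ⟨R, hR, hR.1 _ _ h⟩, fun P Q ⟨R, hR, h⟩ α P' hα hP => ?_⟩
  obtain ⟨Q', hQ, h'⟩ := hR.2 _ _ h α P' hα hP
  exact ⟨Q', hQ, R, hR, h'⟩

theorem Bisim.refl (P : Proc V) : Bisim P P :=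
  ⟨Eq, ⟨fun _ _ h => h.symm, fun _ _ h _ P' _ hP => ⟨P', h ▸ hP, rfl⟩⟩, rfl⟩

theorem Bisim.symm {P Q : Proc V} (h : Bisim P Q) : Bisim Q P :=
  isBisimulation_bisim.1 _ _ h

theorem Act.map_symm_map (σ : Equiv.Perm V) (α : Act V) : (α.map σ.symm).map σ = α := by
  cases α <;> simp [Act.map]

theorem Term.map_symm_map {c : Cat} (σ : Equiv.Perm V) (P : Term c V) :
    (P.map σ.symm).map σ = P := by
  rw [Term.map_map]
  exact P.map_eq_self fun a _ => by simp

theorem Term.map_map_symm {c : Cat} (σ : Equiv.Perm V) (P : Term c V) :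
    (P.map σ).map σ.symm = P := by
  simpa using P.map_symm_map σ.symm

/-- Bisimilarity is preserved by permutations of the names. -/
theorem Bisim.map {P Q : Proc V} (h : Bisim P Q) (σ : Equiv.Perm V) :
    Bisim (P.map σ) (Q.map σ) := by
  refine ⟨fun P Q => Bisim (P.map σ.symm) (Q.map σ.symm), ⟨fun _ _ h => h.symm, ?_⟩, ?_⟩
  · intro P Q h α P' hα hP
    obtain ⟨Q', hQ, h'⟩ := isBisimulation_bisim.2 _ _ h _ _ (by
      rw [Act.bn_map, Term.fn_map, Term.fn_map, ← Set.image_union]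
      exact (Set.disjoint_image_iff σ.symm.injective).2 hα) (hP.map σ.symm)
    refine ⟨Q'.map σ, ?_, ?_⟩
    · simpa only [Act.map_symm_map, Term.map_symm_map] using hQ.map σ
    · simpa only [Term.map_map_symm] using h'
  · simpa only [Term.map_map_symm] using h

/-- The least equivalence relation that contains bisimilarity, satisfies the structural laws of
parallel composition and restriction, and is compatible with both. It is shown below that it is a
bisimulation, so that it is bisimilarity. -/
inductive Struct : Proc V → Proc V → Prop
  | bisim {P Q : Proc V} : Bisim P Q → Struct P Q
  | symm {P Q : Proc V} : Struct P Q → Struct Q P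
  | trans {P Q R : Proc V} : Struct P Q → Struct Q R → Struct P R
  | par {P Q : Proc V} (R : Proc V) : Struct P Q → Struct (.par P R) (.par Q R)
  | res {P Q : Proc V} (z : V) : Struct P Q → Struct (.res (abs z P)) (.res (abs z Q))
  | comm (P Q : Proc V) : Struct (.par P Q) (.par Q P)
  | assoc (P Q R : Proc V) : Struct (.par (.par P Q) R) (.par P (.par Q R))
  | parNil (P : Proc V) : Struct (.par P nil) P
  /-- Scope extrusion `νz.P ∣ Q ∼ νz(P ∣ Q)`, where `z` is not free in `Q`. -/
  | extr (B : Proc (Option V)) (Q : Proc V) :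
      Struct (.par (.res B) Q) (.res (.par B (Q.map some)))
  | resComm {z w : V} (h : z ≠ w) (P : Proc V) :
      Struct (.res (abs z (.res (abs w P)))) (.res (abs w (.res (abs z P))))

namespace Struct

theorem refl (P : Proc V) : Struct P P := .bisim (.refl P)

theorem parRight (P : Proc V) {Q R : Proc V} (h : Struct Q R) :
    Struct (.par P Q) (.par P R) :=
  (comm _ _).trans ((h.par _).trans (comm _ _))

theorem extr_abs {z : V} (P : Proc V) {Q : Proc V} (h : z ∉ Q.fn) :
    Struct (.par (.res (abs z P)) Q) (.res (abs z (.par P Q))) := by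
  rw [abs_par_right P h]
  exact extr _ _

theorem extr_abs_right {z : V} {P : Proc V} (Q : Proc V) (h : z ∉ P.fn) :
    Struct (.par P (.res (abs z Q))) (.res (abs z (.par P Q))) :=
  (comm _ _).trans ((extr_abs Q h).trans ((comm _ _).res z))

theorem map {P Q : Proc V} (h : Struct P Q) (σ : Equiv.Perm V) :
    Struct (P.map σ) (Q.map σ) := by
  induction h with
  | bisim h => exact .bisim (h.map σ)
  | symm _ ih => exact ih.symm
  | trans _ _ ih₁ ih₂ => exact ih₁.trans ih₂
  | par R _ ih => exact ih.par _
  | res z _ ih => simp only [Term.map, abs_map σ.injective]; exact ih.res _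
  | comm => exact comm _ _
  | assoc => exact assoc _ _ _
  | parNil => exact parNil _
  | extr B Q =>
    have : (Q.map some).map (Option.map σ) = (Q.map σ).map some := by
      simp only [Term.map_map]; rfl
    simp only [Term.map, this]
    exact extr _ _
  | resComm h => simp only [Term.map, abs_map σ.injective]; exact resComm (σ.injective.ne h) _

end Struct

/-- The exchange of the two outermost bound names. -/
def exchange : Option (Option V) → Option (Option V)
  | none => some none
  | some none => none
  | some (some a) => some (some a)

/-- Every transition of `P` whose bound name is not in `F` is matched by one of `Q`, up to
`Struct`. -/
def SimOutside (F : Set V) (P Q : Proc V) : Prop :=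
  ∀ α P', Disjoint α.bn F → Step P α P' → ∃ Q', Step Q α Q' ∧ Struct P' Q'

theorem SimOutside.map {F : Set V} {P Q : Proc V} (h : SimOutside F P Q) (σ : Equiv.Perm V) :
    SimOutside (σ '' F) (P.map σ) (Q.map σ) := by
  intro α P' hα hP
  have hP' := hP.map σ.symm
  rw [Term.map_map_symm] at hP'
  obtain ⟨Q', hQ, h'⟩ := h _ _ (by
    rw [Act.bn_map]
    have := (Set.disjoint_image_iff σ.symm.injective).2 hα
    simpa [Set.image_image] using this) hP'
  refine ⟨Q'.map σ, ?_, ?_⟩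
  · simpa only [Act.map_symm_map] using hQ.map σ
  · simpa only [Term.map_symm_map] using h'.map σ

/-- Every transition of `P` is matched by one of `Q` up to `Struct`, provided that its bound name
is outside some finite set. The choice of the finite set makes this relation transitive. -/
def Sim (P Q : Proc V) : Prop :=
  ∃ F : Set V, F.Finite ∧ SimOutside F P Q

namespace Sim

theorem of_bisim {P Q : Proc V} (h : Bisim P Q) : Sim P Q := by
  refine ⟨P.fn ∪ Q.fn, P.finite_fn.union Q.finite_fn, fun α P' hα hP => ?_⟩
  obtain ⟨Q', hQ, h'⟩ := isBisimulation_bisim.2 _ _ h α P' hα hP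
  exact ⟨Q', hQ, .bisim h'⟩

theorem trans {P Q R : Proc V} (h₁ : Sim P Q) (h₂ : Sim Q R) : Sim P R := by
  obtain ⟨F, hF, h₁⟩ := h₁
  obtain ⟨G, hG, h₂⟩ := h₂
  refine ⟨F ∪ G, hF.union hG, fun α P' hα hP => ?_⟩
  rw [Set.disjoint_union_right] at hα
  obtain ⟨Q', hQ, hPQ⟩ := h₁ α P' hα.1 hP
  obtain ⟨R', hR, hQR⟩ := h₂ α Q' hα.2 hQ
  exact ⟨R', hR, hPQ.trans hQR⟩

theorem parNil' (P : Proc V) : Sim P (.par P nil) :=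
  ⟨∅, Set.finite_empty, fun _ _ _ hP =>
    ⟨_, .parL hP (by simp [nil, Term.fn]), (Struct.parNil _).symm⟩⟩

variable [Infinite V]

theorem par {P Q : Proc V} (R : Proc V) (hS : Struct P Q) (h : Sim P Q) :
    Sim (.par P R) (.par Q R) := by
  obtain ⟨F, hF, h⟩ := h
  refine ⟨F ∪ Q.fn, hF.union Q.finite_fn, fun α T hα hT => ?_⟩
  rw [Set.disjoint_union_right] at hα
  cases hT.parStep (hF.union Q.finite_fn) with
  | left hP hd =>
    obtain ⟨Q', hQ, h'⟩ := h _ _ hα.1 hP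
    exact ⟨_, .parL hQ hd, h'.par R⟩
  | right hR hd => exact ⟨_, .parR hR hα.2, hS.par _⟩
  | commL hP hR =>
    obtain ⟨Q', hQ, h'⟩ := h _ _ (by simp [Act.bn]) hP
    exact ⟨_, .commL hQ hR, h'.par _⟩
  | commR hP hR =>
    obtain ⟨Q', hQ, h'⟩ := h _ _ (by simp [Act.bn]) hP
    exact ⟨_, .commR hQ hR, h'.par _⟩
  | closeL hP hR hz hzP hzR =>
    simp only [Set.mem_union, not_or] at hz
    obtain ⟨Q', hQ, h'⟩ := h _ _ (by simp [Act.bn, hz]) hP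
    exact ⟨_, .closeL hQ hR hzR, (h'.par _).res _⟩
  | closeR hP hR hz hzP hzR =>
    simp only [Set.mem_union, not_or] at hz
    obtain ⟨Q', hQ, h'⟩ := h _ _ (by simp [Act.bn]) hP
    exact ⟨_, .closeR hQ hR hz.2, (h'.par _).res _⟩

theorem comm (P Q : Proc V) : Sim (.par P Q) (.par Q P) := by
  refine ⟨∅, Set.finite_empty, fun α T hα hT => ?_⟩
  cases hT.parStep Set.finite_empty with
  | left hP hd => exact ⟨_, .parR hP hd, .comm _ _⟩
  | right hQ hd => exact ⟨_, .parL hQ hd, .comm _ _⟩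
  | commL hP hQ => exact ⟨_, .commR hQ hP, .comm _ _⟩
  | commR hP hQ => exact ⟨_, .commL hQ hP, .comm _ _⟩
  | closeL hP hQ _ hzP hzQ => exact ⟨_, .closeR hQ hP hzQ, (Struct.comm _ _).res _⟩
  | closeR hP hQ _ hzP hzQ => exact ⟨_, .closeL hQ hP hzP, (Struct.comm _ _).res _⟩

theorem assoc (P Q R : Proc V) : Sim (.par (.par P Q) R) (.par P (.par Q R)) := by
  have hR := R.finite_fn
  have hmem {z : V} {s t : Set V} (h₁ : z ∉ s) (h₂ : z ∉ t) : z ∉ s ∪ t := fun h =>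
    h.elim h₁ h₂
  refine ⟨∅, Set.finite_empty, fun α T hα hT => ?_⟩
  cases hT.parStep Set.finite_empty with
  | left hPQ hd =>
    cases hPQ.parStep hR with
    | left hP hd' => exact ⟨_, .parL hP (Set.disjoint_union_right.2 ⟨hd', hd⟩), .assoc _ _ _⟩
    | right hQ hd' => exact ⟨_, .parR (.parL hQ hd) hd', .assoc _ _ _⟩
    | commL hP hQ => exact ⟨_, .commL hP (.parL hQ (by simp [Act.bn])), .assoc _ _ _⟩
    | commR hP hQ => exact ⟨_, .commR hP (.parL hQ (by simp [Act.bn])), .assoc _ _ _⟩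
    | closeL hP hQ hzR hzP hzQ =>
      exact ⟨_, .closeL hP (.parL hQ (by simp [Act.bn])) (hmem hzQ hzR),
        (Struct.extr_abs _ hzR).trans ((Struct.assoc _ _ _).res _)⟩
    | closeR hP hQ hzR hzP hzQ =>
      exact ⟨_, .closeR hP (.parL hQ (by simp [Act.bn, hzR])) hzP,
        (Struct.extr_abs _ hzR).trans ((Struct.assoc _ _ _).res _)⟩
  | right hR hd =>
    rw [Term.fn, Set.disjoint_union_right] at hd
    exact ⟨_, .parR (.parR hR hd.2) hd.1, .assoc _ _ _⟩
  | commL hPQ hR =>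
    cases hPQ with
    | parL hP hd => exact ⟨_, .commL hP (.parR hR (by simp [Act.bn])), .assoc _ _ _⟩
    | parR hQ hd => exact ⟨_, .parR (.commL hQ hR) (by simp [Act.bn]), .assoc _ _ _⟩
  | commR hPQ hR =>
    cases hPQ with
    | parL hP hd => exact ⟨_, .commR hP (.parR hR (by simp [Act.bn])), .assoc _ _ _⟩
    | parR hQ hd => exact ⟨_, .parR (.commR hQ hR) (by simp [Act.bn]), .assoc _ _ _⟩
  | closeL hPQ hR _ hz hzR =>
    simp only [Term.fn, Set.mem_union, not_or] at hz
    cases hPQ with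
    | parL hP hd =>
      exact ⟨_, .closeL hP (.parR hR (by simp [Act.bn])) (hmem hz.2 hzR),
        (Struct.assoc _ _ _).res _⟩
    | parR hQ hd =>
      exact ⟨_, .parR (.closeL hQ hR hzR) (by simp [Act.bn]),
        ((Struct.assoc _ _ _).res _).trans (Struct.extr_abs_right _ hz.1).symm⟩
  | closeR hPQ hR _ hz hzR =>
    simp only [Term.fn, Set.mem_union, not_or] at hz
    cases hPQ with
    | parL hP hd =>
      exact ⟨_, .closeR hP (.parR hR (by simp [Act.bn, hz])) hz.1,
        (Struct.assoc _ _ _).res _⟩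
    | parR hQ hd =>
      exact ⟨_, .parR (.closeR hQ hR hz.2) (by simp [Act.bn]),
        ((Struct.assoc _ _ _).res _).trans (Struct.extr_abs_right _ hz.1).symm⟩

/-- The converse of `Sim.assoc`, by commutativity. -/
theorem assoc' (P Q R : Proc V) : Sim (.par P (.par Q R)) (.par (.par P Q) R) :=
  (comm _ _).trans <| (par _ (.comm _ _) (comm _ _)).trans <| (assoc _ _ _).trans <|
    (comm _ _).trans (par _ (.comm _ _) (comm _ _))

theorem parNil (P : Proc V) : Sim (.par P nil) P := by
  refine ⟨∅, Set.finite_empty, fun α T hα hT => ?_⟩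
  cases hT.parStep Set.finite_empty with
  | left hP hd => exact ⟨_, hP, .parNil _⟩
  | right h | commL _ h | commR _ h | closeL _ h | closeR _ h => exact (not_step_nil h).elim

theorem res {P Q : Proc V} (z : V) (h : Sim P Q) : Sim (.res (abs z P)) (.res (abs z Q)) := by
  classical
  obtain ⟨F, hF, h⟩ := h
  have hz (P : Proc V) : some z ∉ (abs z P).fn := by simp [some_mem_fn_abs]
  -- The bound name `z` is replaced by a name `w` that is fresh for the transition.
  have key {w : V} (hP : some w ∉ (abs z P).fn) (hQ : some w ∉ (abs z Q).fn) :
      SimOutside (Equiv.swap z w '' F) (inst (abs z P) w) (inst (abs z Q) w) := by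
    rw [← inst_map_swap (hz P) hP, ← inst_map_swap (hz Q) hQ, inst_abs_self, inst_abs_self]
    exact h.map _
  have hQ : {a | some a ∈ (abs z Q).fn}.Finite := (Term.res (abs z Q)).finite_fn
  refine ⟨F ∪ {a | some a ∈ (abs z Q).fn}, hF.union hQ, fun α T hα hT => ?_⟩
  rw [Set.disjoint_union_right] at hα
  cases hT.resStep (hF.union hQ) with
  | @res _ w P' hP hwα hwF hwB =>
    simp only [Set.mem_union, not_or] at hwF
    obtain ⟨Q', hQ, h'⟩ := key hwB hwF.2 _ _ (by
      rw [Set.disjoint_left] at hα ⊢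
      rintro a ha ⟨b, hb, rfl⟩
      by_cases hbz : b = z
      · rw [hbz, Equiv.swap_apply_left] at ha
        exact hwα (α.bn_subset_names ha)
      · rw [Equiv.swap_apply_of_ne_of_ne hbz (by rintro rfl; exact hwF.1 hb)] at ha
        exact hα.1 ha hb) hP
    exact ⟨_, hQ.res_of_inst hwα hwF.2, h'.res w⟩
  | opn hP hw hwB =>
    have hwQ := Set.disjoint_singleton_left.1 hα.2
    obtain ⟨Q', hQ, h'⟩ := key hwB hwQ _ _ (by simp [Act.bn]) hP
    exact ⟨_, hQ.opn_of_inst hw hwQ, h'⟩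

theorem extr (B : Proc (Option V)) (Q : Proc V) :
    Sim (.par (.res B) Q) (.res (.par B (Q.map some))) := by
  -- A transition of `inst B z ∣ Q` is one of the body on the right.
  have lift {z : V} {α : Act V} {T : Proc V} (h : Step (.par (inst B z) Q) α T)
      (hα : z ∉ α.names) (hB : some z ∉ B.fn) (hQ : z ∉ Q.fn) :
      Step (.res (.par B (Q.map some))) α (.res (abs z T)) :=
    Step.res_of_inst (by rwa [inst_par, inst_map_some]) hα
      (by simp [Term.fn, Term.fn_map, hB, hQ])
  refine ⟨∅, Set.finite_empty, fun α T _ hT => ?_⟩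
  have hQ := Q.finite_fn
  cases hT.parStep Set.finite_empty with
  | @left _ P' hR hd =>
    cases hR.resStep hQ with
    | res hB hzα hzQ hzB => exact ⟨_, lift (.parL hB hd) hzα hzB hzQ, .extr_abs _ hzQ⟩
    | @opn x z _ hB hz hzB =>
      have hzQ := Set.disjoint_singleton_left.1 hd
      refine ⟨.par P' Q, Step.opn_of_inst ?_ hz ?_, .refl _⟩
      · rw [inst_par, inst_map_some]
        exact .parL hB (by simp [Act.bn])
      · simp [Term.fn, Term.fn_map, hzB, hzQ]
  | @right _ Q' hQ' hd =>
    obtain ⟨z, hz⟩ := exists_fresh ((Term.res B).finite_fn.union (hQ.union α.finite_names))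
    simp only [Set.mem_union, not_or] at hz
    obtain ⟨hzB, hzQ, hzα⟩ := hz
    refine ⟨_, lift (.parR hQ' ?_) hzα hzB hzQ, ?_⟩
    · rw [Set.disjoint_left] at hd ⊢
      exact fun a ha h => (mem_fn_inst h).elim (hd ha)
        fun e => hzα (e ▸ α.bn_subset_names ha)
    · have := Struct.extr_abs (inst B z) (hQ'.notMem_of_notMem hzQ hzα)
      rwa [abs_inst hzB] at this
  | @commL x y P' Q' hR hQ' =>
    cases hR.resStep hQ with
    | res hB hzα hzQ hzB =>
      exact ⟨_, lift (.commL hB hQ') (by simp [Act.names]) hzB hzQ,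
        .extr_abs _ (hQ'.notMem_of_notMem hzQ hzα)⟩
  | commR hR hQ' =>
    cases hR.resStep hQ with
    | res hB hzα hzQ hzB =>
      exact ⟨_, lift (.commR hB hQ') (by simp [Act.names]) hzB hzQ,
        .extr_abs _ (hQ'.notMem_of_notMem hzQ hzα)⟩
  | @closeL x w P' Q' hR hQ' _ hwB hwQ =>
    cases hR.resStep hQ with
    | @res _ z P' hB hzα hzQ hzB =>
      have hwz : w ≠ z := by rintro rfl; simp [Act.names] at hzα
      exact ⟨_, lift (.closeL hB hQ' hwQ) (by simp [Act.names]) hzB hzQ,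
        ((Struct.extr_abs _ (hQ'.notMem_of_notMem hzQ hzα)).res w).trans (.resComm hwz _)⟩
    -- A scope extrusion becomes a communication under the restriction.
    | opn hB hw _ =>
      refine ⟨_, Step.res_of_inst (.commL (Q := inst _ w) hB ?_) (by simp [Act.names]) ?_,
        .refl _⟩
      · rwa [inst_map_some]
      · exact fun h => h.elim hwB (by simp [Term.fn_map, hwQ])
  | @closeR x w P' Q' hR hQ' _ hwB hwQ =>
    cases hR.resStep hQ with
    | @res _ z P' hB hzα hzQ hzB =>
      have hwz : w ≠ z := by rintro rfl; simp [Act.names] at hzα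
      exact ⟨_, lift (.closeR hB hQ' (fun h => (mem_fn_inst h).elim hwB hwz))
        (by simp [Act.names]) hzB hzQ,
        ((Struct.extr_abs _ (hQ'.notMem_of_notMem hzQ hzα)).res w).trans (.resComm hwz _)⟩

theorem extr' (B : Proc (Option V)) (Q : Proc V) :
    Sim (.res (.par B (Q.map some))) (.par (.res B) Q) := by
  refine ⟨∅, Set.finite_empty, fun α T _ hR => ?_⟩
  cases hR.resStep Set.finite_empty with
  | @res _ z T hT hzα _ hz =>
    rw [inst_par, inst_map_some] at hT
    simp only [Term.fn, Term.fn_map, Set.mem_union, not_or] at hz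
    have hzB := hz.1
    have hzQ : z ∉ Q.fn := by simpa using hz.2
    have ne {x : V} (hx : x ∈ Q.fn) : z ≠ x := by rintro rfl; exact hzQ hx
    have hd {β : Act V} (h : Disjoint β.bn (inst B z).fn) : Disjoint β.bn (Term.res B).fn := by
      rw [Set.disjoint_left] at h ⊢
      exact fun a ha hB => h ha (mem_fn_inst_of_some hB)
    cases hT.parStep (Set.finite_singleton z) with
    | left hB hd => exact ⟨_, .parL (hB.res_of_inst hzα hzB) hd, (Struct.extr_abs _ hzQ).symm⟩
    | @right _ Q' hQ h =>
      refine ⟨_, .parR hQ (hd h), ?_⟩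
      have := Struct.extr_abs (inst B z) (hQ.notMem_of_notMem hzQ hzα)
      rw [abs_inst hzB] at this
      exact this.symm
    | @commL x y P' Q' hB hQ =>
      have hx := ne hQ.inp_mem
      by_cases hy : z = y
      -- The name sent is the restricted one: a communication under the restriction becomes a
      -- scope extrusion.
      · subst hy
        exact ⟨_, .closeL (hB.opn_of_inst hx hzB) hQ hzQ, .refl _⟩
      · have hα : z ∉ (Act.inp x y).names := by simp [Act.names, hx, hy]
        exact ⟨_, .commL (hB.res_of_inst hα hzB) hQ,
          (Struct.extr_abs _ (hQ.notMem_of_notMem hzQ hα)).symm⟩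
    | @commR x y P' Q' hB hQ =>
      have hα : z ∉ (Act.out x y).names := by
        simp [Act.names, ne hQ.out_mem.1, ne hQ.out_mem.2]
      exact ⟨_, .commR (hB.res_of_inst hα hzB) hQ,
        (Struct.extr_abs _ (hQ.notMem_of_notMem hzQ hα)).symm⟩
    | @closeL x w P' Q' hB hQ hw hwB hwQ =>
      have hα : z ∉ (Act.inp x w).names := by
        simp [Act.names, ne hQ.inp_mem, Ne.symm hw]
      exact ⟨_, .closeL (hB.res_of_inst hα hzB) hQ hwQ, (Struct.resComm (Ne.symm hw) _).trans
        ((Struct.extr_abs _ (hQ.notMem_of_notMem hzQ hα)).symm.res w)⟩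
    | @closeR x w P' Q' hB hQ hw hwB hwQ =>
      have hα : z ∉ (Act.bout x w).names := by
        simp [Act.names, ne hQ.bout_mem.1, Ne.symm hw]
      exact ⟨_, .closeR (hB.res_of_inst hα hzB) hQ fun h => hwB (mem_fn_inst_of_some h),
        (Struct.resComm (Ne.symm hw) _).trans
        ((Struct.extr_abs _ (hQ.notMem_of_notMem hzQ hα)).symm.res w)⟩
  | @opn x z T hT hz hzB =>
    rw [inst_par, inst_map_some] at hT
    simp only [Term.fn, Term.fn_map, Set.mem_union, not_or] at hzB
    have hzQ : z ∉ Q.fn := by simpa using hzB.2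
    cases hT with
    | parL hB => exact ⟨_, .parL (hB.opn_of_inst hz hzB.1) (by simp [Act.bn, hzQ]), .refl _⟩
    | parR hQ => exact (hzQ hQ.out_mem.2).elim

/-- The bodies of `νzνw.P` and `νwνz.P` differ by the exchange of the two bound names. -/
theorem resComm_exchange (D : Proc (Option (Option V))) :
    Sim (.res (.res D)) (.res (.res (D.map exchange))) := by
  -- Instantiation of the two binders, in either order, gives the same process.
  have inst_inst (z w : V) : inst ((D.map exchange).map (Option.map fun o => o.getD w)) z =
      inst (D.map (Option.map fun o => o.getD z)) w := by
    simp only [inst, Term.map_map]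
    refine D.map_congr ?_
    rintro (_ | _ | a) _ <;> rfl
  have fresh {z w : V} (h : z ≠ w) (hz : some (some z) ∉ D.fn) :
      some z ∉ ((D.map exchange).map (Option.map fun o => o.getD w)).fn := by
    simp only [Term.map_map, Term.fn_map, Set.mem_image, not_exists, not_and]
    rintro (_ | _ | a) ha <;> simp_all [exchange, eq_comm]
    rintro rfl; exact hz ha
  have fresh' {z w : V} (hw : some w ∉ (D.map (Option.map fun o => o.getD z)).fn) :
      some w ∉ (Term.res (D.map exchange)).fn := by
    intro h
    simp only [Term.fn, Term.fn_map, Set.mem_ofPred_eq, Set.mem_image] at h hw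
    obtain ⟨_ | _ | a, ha, h⟩ := h <;> simp [exchange] at h
    subst h
    exact hw ⟨_, ha, rfl⟩
  refine ⟨∅, Set.finite_empty, fun α T _ hT => ?_⟩
  cases hT.resStep α.finite_names with
  | @res _ z T hC hzα _ hzD =>
    have hC : Step (.res (D.map (Option.map fun o => o.getD z))) α T := hC
    cases hC.resStep (Set.finite_singleton z) with
    | @res _ w P' hP hwα hwz hwD =>
      rw [← inst_inst] at hP
      exact ⟨_, Step.res_of_inst (B := .res _) (z := w) (Step.res_of_inst hP hzα
        (fresh (Ne.symm hwz) hzD)) hwα (fresh' hwD), .resComm (Ne.symm hwz) _⟩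
    | @opn x w P' hP hw hwD =>
      simp only [Act.names, Set.mem_insert_iff, Set.mem_singleton_iff, not_or] at hzα
      rw [← inst_inst] at hP
      exact ⟨_, Step.opn_of_inst (B := .res _) (z := w) (Step.res_of_inst hP
        (by simp [Act.names, hzα]) (fresh hzα.2 hzD)) hw (fresh' hwD), .refl _⟩
  | @opn x z T hC hz hzD =>
    have hC : Step (.res (D.map (Option.map fun o => o.getD z))) (.out x z) T := hC
    cases hC.resStep (Set.finite_singleton z) with
    | @res _ w P' hP hwα hwz hwD =>
      simp only [Act.names, Set.mem_insert_iff, Set.mem_singleton_iff, not_or] at hwα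
      rw [← inst_inst] at hP
      exact ⟨_, Step.res_of_inst (B := .res _) (z := w) (Step.opn_of_inst hP hz
        (fresh (Ne.symm hwz) hzD)) (by simp [Act.names, hwα]) (fresh' hwD), .refl _⟩

theorem resComm {z w : V} (h : z ≠ w) (P : Proc V) :
    Sim (.res (abs z (.res (abs w P)))) (.res (abs w (.res (abs z P)))) := by
  classical
  have := resComm_exchange ((abs w P).map (Option.map fun x => if x = z then none else some x))
  refine (congrArg (Sim _ ∘ Term.res) ?_).mp this
  change Term.res _ = Term.res _
  simp only [abs, Term.map_map]
  congr 1
  refine P.map_congr fun a _ => ?_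
  by_cases h₁ : a = z <;> by_cases h₂ : a = w <;> simp_all [exchange]

end Sim

/-- `Struct` is a bisimulation for actions with a sufficiently fresh bound name. -/
theorem Struct.sim [Infinite V] {P Q : Proc V} (h : Struct P Q) : Sim P Q ∧ Sim Q P := by
  induction h with
  | bisim h => exact ⟨.of_bisim h, .of_bisim h.symm⟩
  | symm _ ih => exact ih.symm
  | trans _ _ ih₁ ih₂ => exact ⟨ih₁.1.trans ih₂.1, ih₂.2.trans ih₁.2⟩
  | par R h ih => exact ⟨.par R h ih.1, .par R h.symm ih.2⟩
  | res z h ih => exact ⟨.res z ih.1, .res z ih.2⟩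
  | comm P Q => exact ⟨.comm _ _, .comm _ _⟩
  | assoc P Q R => exact ⟨.assoc _ _ _, .assoc' _ _ _⟩
  | parNil P => exact ⟨.parNil P, .parNil' P⟩
  | extr B Q => exact ⟨.extr B Q, .extr' B Q⟩
  | resComm h P => exact ⟨.resComm h P, .resComm h.symm P⟩

theorem isBisimulation_struct [Infinite V] : IsBisimulation (Struct (V := V)) := by
  classical
  refine ⟨fun _ _ h => h.symm, fun P Q h α P' hα hP => ?_⟩
  obtain ⟨F, hF, hsim⟩ := h.sim.1
  cases α with
  -- A bound name `z` in the finite set `F` is exchanged for a fresh name `w` and back.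
  | bout x z =>
    simp only [Act.bn, Set.disjoint_singleton_left, Set.mem_union, not_or] at hα
    obtain ⟨w, hw⟩ := exists_fresh (hF.union (P.finite_fn.union Q.finite_fn))
    simp only [Set.mem_union, not_or] at hw
    obtain ⟨Q', hQ, h'⟩ := hsim _ _ (by simp [Act.bn, hw.1]) (hP.bout_swap hw.2.1)
    refine ⟨Q'.map (Equiv.swap w z), hQ.bout_swap hα.2, ?_⟩
    have := h'.map (Equiv.swap w z)
    rwa [Term.map_map, Equiv.swap_comm z w, Term.map_eq_self P' (by simp)] at this
  | _ => exact hsim _ _ (by simp [Act.bn]) hP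

theorem Struct.toBisim [Infinite V] {P Q : Proc V} (h : Struct P Q) : Bisim P Q :=
  ⟨_, isBisimulation_struct, h⟩

/-! ### Unique decomposition from a reduction relation -/

/-- A relation `red` on a commutative monoid with an additive depth `d` that vanishes only at the
identity: reduction decreases the depth, is possible for every element but the identity, and a
product reduces precisely by the reduction of a factor. -/
structure IsReduction {M : Type u} [CommMonoid M] (d : M → ℕ) (red : M → M → Prop) : Prop where
  depth_mul (x y : M) : d (x * y) = d x + d y
  eq_one {x : M} : d x = 0 → x = 1
  depth_lt {x y : M} : red x y → d y < d x
  mul_right {x x' : M} (y : M) : red x x' → red (x * y) (x' * y)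
  of_mul {x y w : M} : red (x * y) w → (∃ x', red x x' ∧ w = x' * y) ∨ ∃ y', red y y' ∧ w = x * y'
  exists_red {x : M} : x ≠ 1 → ∃ y, red x y

namespace IsReduction

variable {M : Type u} [CommMonoid M] {d : M → ℕ} {red : M → M → Prop}

theorem depth_one (h : IsReduction d red) : d 1 = 0 := by
  have := h.depth_mul 1 1
  rw [mul_one] at this
  omega

theorem depth_pos (h : IsReduction d red) {x : M} (hx : x ≠ 1) : 0 < d x :=
  Nat.pos_of_ne_zero fun h0 => hx (h.eq_one h0)

theorem depth_le_prod (h : IsReduction d red) {p : M} {A : Multiset M} (hp : p ∈ A) :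
    d p ≤ d A.prod := by
  obtain ⟨B, rfl⟩ := Multiset.exists_cons_of_mem hp
  rw [Multiset.prod_cons, h.depth_mul]
  omega

theorem card_le_depth_prod (h : IsReduction d red) {A : Multiset M}
    (hA : ∀ p ∈ A, Indecomposable p) : A.card ≤ d A.prod := by
  induction A using Multiset.induction_on with
  | empty => simp
  | cons p A ih =>
    rw [Multiset.prod_cons, h.depth_mul, Multiset.card_cons]
    have := h.depth_pos (hA p (Multiset.mem_cons_self _ _)).1
    have := ih fun q hq => hA q (Multiset.mem_cons_of_mem hq)
    omega

theorem exists_decomposition (h : IsReduction d red) (x : M) :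
    ∃ A : Multiset M, IsDecomposition A x := by
  induction hn : d x using Nat.strong_induction_on generalizing x with
  | _ n ih =>
    by_cases h1 : x = 1
    · exact ⟨0, by simp, by simp [h1]⟩
    by_cases hx : Indecomposable x
    · exact ⟨{x}, by simpa using hx, by simp⟩
    simp only [Indecomposable, not_and, not_forall, not_or] at hx
    obtain ⟨y, z, rfl, hy, hz⟩ := hx h1
    have hd := h.depth_mul y z
    have := h.depth_pos hy
    have := h.depth_pos hz
    obtain ⟨A, hA, rfl⟩ := ih (d y) (by omega) y rfl
    obtain ⟨B, hB, rfl⟩ := ih (d z) (by omega) z rfl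
    refine ⟨A + B, fun p hp => ?_, Multiset.prod_add _ _⟩
    exact (Multiset.mem_add.1 hp).elim (hA p) (hB p)

theorem exists_mem_of_prod [DecidableEq M] (h : IsReduction d red) {A : Multiset M} {w : M}
    (hw : red A.prod w) : ∃ r ∈ A, ∃ r', red r r' ∧ w = r' * (A.erase r).prod := by
  induction A using Multiset.induction_on generalizing w with
  | empty =>
    have := h.depth_lt hw
    rw [Multiset.prod_zero, h.depth_one] at this
    omega
  | cons p A ih =>
    rw [Multiset.prod_cons] at hw
    obtain ⟨p', hp, rfl⟩ | ⟨w, hA, rfl⟩ := h.of_mul hw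
    · exact ⟨p, Multiset.mem_cons_self _ _, p', hp, by simp⟩
    · obtain ⟨r, hr, r', hr', rfl⟩ := ih hA
      refine ⟨r, Multiset.mem_cons_of_mem hr, r', hr', ?_⟩
      rw [Multiset.erase_cons_tail_of_mem hr, Multiset.prod_cons, mul_left_comm]

/-- If smaller elements have at most one decomposition, then a reduction of a component `q` of one
decomposition of `x` is matched by that of a component `r` of any other, with the same
decomposition of the resulting element. -/
theorem exists_match [DecidableEq M] (h : IsReduction d red) {A B : Multiset M}
    (hA : ∀ p ∈ A, Indecomposable p) (hB : ∀ p ∈ B, Indecomposable p) (hAB : A.prod = B.prod)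
    (hU : ∀ C D : Multiset M, (∀ p ∈ C, Indecomposable p) → (∀ p ∈ D, Indecomposable p) →
      C.prod = D.prod → d C.prod < d A.prod → C = D)
    {q : M} {C : Multiset M} (hq : q ∈ A) (hC : ∀ p ∈ C, Indecomposable p)
    (hred : red q C.prod) :
    ∃ r ∈ B, ∃ E : Multiset M, (∀ p ∈ E, Indecomposable p) ∧ red r E.prod ∧
      C + A.erase q = E + B.erase r := by
  have hx : red A.prod (C + A.erase q).prod := by
    rw [Multiset.prod_add]
    conv_lhs => rw [← Multiset.cons_erase hq, Multiset.prod_cons]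
    exact h.mul_right _ hred
  obtain ⟨r, hr, r', hr', he⟩ := h.exists_mem_of_prod (hAB ▸ hx)
  obtain ⟨E, hE, rfl⟩ := h.exists_decomposition r'
  refine ⟨r, hr, E, hE, hr', hU _ _ ?_ ?_ ?_ (h.depth_lt hx)⟩
  · exact fun p hp => (Multiset.mem_add.1 hp).elim (hC p)
      fun hp => hA p (Multiset.mem_of_mem_erase hp)
  · exact fun p hp => (Multiset.mem_add.1 hp).elim (hE p)
      fun hp => hB p (Multiset.mem_of_mem_erase hp)
  · rw [he, Multiset.prod_add]

/-- Two decompositions of the same element cannot first differ, in order of decreasing depth, at a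
component `p`. -/
theorem false_of_count_lt [DecidableEq M] (h : IsReduction d red) {A B : Multiset M}
    (hA : ∀ p ∈ A, Indecomposable p) (hB : ∀ p ∈ B, Indecomposable p) (hAB : A.prod = B.prod)
    (hU : ∀ C D : Multiset M, (∀ p ∈ C, Indecomposable p) → (∀ p ∈ D, Indecomposable p) →
      C.prod = D.prod → d C.prod < d A.prod → C = D)
    {p : M} (hp : B.count p < A.count p) (hgt : ∀ q, d p < d q → A.count q = B.count q) :
    False := by
  have hpA : p ∈ A := Multiset.count_pos.1 (by omega)
  have count_eq_zero {q r : M} {E : Multiset M} (hr : red r E.prod) (hle : d r ≤ d q) :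
      E.count q = 0 := by
    refine Multiset.count_eq_zero.2 fun hq => ?_
    have := h.depth_le_prod hq
    have := h.depth_lt hr
    omega
  have exists_red {q : M} (hq : Indecomposable q) :
      ∃ C : Multiset M, (∀ p ∈ C, Indecomposable p) ∧ red q C.prod := by
    obtain ⟨q', hq'⟩ := h.exists_red hq.1
    obtain ⟨C, hC, rfl⟩ := h.exists_decomposition q'
    exact ⟨C, hC, hq'⟩
  -- A component `q` of greater depth would have reducts with arbitrarily many components `p`.
  have hle : ∀ q ∈ A, d q ≤ d p := by
    intro q hq
    by_contra! hlt
    have key (k : ℕ) : ∃ C : Multiset M,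
        (∀ p ∈ C, Indecomposable p) ∧ red q C.prod ∧ k ≤ C.count p := by
      induction k with
      | zero =>
        obtain ⟨C, hC, hred⟩ := exists_red (hA q hq)
        exact ⟨C, hC, hred, Nat.zero_le _⟩
      | succ k ih =>
        obtain ⟨C, hC, hred, hk⟩ := ih
        obtain ⟨r, hr, E, hE, hrE, he⟩ := h.exists_match hA hB hAB hU hq hC hred
        have hrq : r = q := by
          by_contra hne
          rcases le_or_gt (d r) (d q) with hd | hd
          · have := congrArg (Multiset.count q) he
            rw [Multiset.count_add, Multiset.count_add, Multiset.count_erase_self,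
              Multiset.count_erase_of_ne (Ne.symm hne), count_eq_zero hred le_rfl,
              count_eq_zero hrE hd, hgt q hlt] at this
            have : 0 < A.count q := Multiset.count_pos.2 hq
            have := hgt q hlt
            omega
          · have := congrArg (Multiset.count r) he
            rw [Multiset.count_add, Multiset.count_add, Multiset.count_erase_self,
              Multiset.count_erase_of_ne hne, count_eq_zero hred hd.le,
              count_eq_zero hrE le_rfl, hgt r (by omega)] at this
            have : 0 < B.count r := Multiset.count_pos.2 hr
            omega
        subst hrq
        have hne : p ≠ r := by rintro rfl; omega
        have := congrArg (Multiset.count p) he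
        rw [Multiset.count_add, Multiset.count_add, Multiset.count_erase_of_ne hne,
          Multiset.count_erase_of_ne hne] at this
        exact ⟨E, hE, hrE, by omega⟩
    obtain ⟨C, hC, hred, hk⟩ := key (d q)
    have := h.depth_lt hred
    have := h.card_le_depth_prod hC
    have := Multiset.count_le_card p C
    omega
  have hleB : ∀ r ∈ B, d r ≤ d p := by
    intro r hr
    by_contra! hlt
    have := hle r (Multiset.count_pos.1 (hgt r hlt ▸ Multiset.count_pos.2 hr))
    omega
  -- The reduction of any component of `A` leaves at most `B.count p` components `p`.
  have hcount : ∀ q ∈ A, (A.erase q).count p ≤ B.count p := by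
    intro q hq
    obtain ⟨C, hC, hred⟩ := exists_red (hA q hq)
    obtain ⟨r, hr, E, hE, hrE, he⟩ := h.exists_match hA hB hAB hU hq hC hred
    have := congrArg (Multiset.count p) he
    rw [Multiset.count_add, Multiset.count_add, count_eq_zero hrE (hleB r hr)] at this
    have := Multiset.count_le_of_le p (Multiset.erase_le r B)
    omega
  have hall : ∀ q ∈ A, q = p := by
    intro q hq
    by_contra hne
    have := hcount q hq
    rw [Multiset.count_erase_of_ne (Ne.symm hne)] at this
    omega
  have hcard : A.count p = A.card := Multiset.count_eq_card.2 fun q hq => (hall q hq).symm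
  by_cases h1 : A.card = 1
  · obtain ⟨p', rfl⟩ := Multiset.card_eq_one.1 h1
    obtain rfl : p = p' := by simpa using hpA
    rw [Multiset.prod_singleton] at hAB
    have hpi := hA p (by simp)
    induction B using Multiset.induction_on with
    | empty => exact hpi.1 (by simpa using hAB)
    | cons r B _ =>
      rw [Multiset.prod_cons] at hAB
      rcases hpi.2 _ _ hAB with hr | hB1
      · exact (hB r (Multiset.mem_cons_self _ _)).1 hr
      · rw [hB1, mul_one] at hAB
        subst hAB
        simp at hp
  · have h2 := hcount p hpA
    rw [Multiset.count_erase_self] at h2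
    have hpB : p ∈ B := Multiset.count_pos.1 (by
      have := Multiset.card_pos_iff_exists_mem.2 ⟨p, hpA⟩
      omega)
    obtain ⟨C, hC, hred⟩ := exists_red (hB p hpB)
    obtain ⟨r, hr, E, hE, hrE, he⟩ := h.exists_match hB hA hAB.symm (hAB ▸ hU) hpB hC hred
    obtain rfl := hall r hr
    have := congrArg (Multiset.count r) he
    rw [Multiset.count_add, Multiset.count_add, Multiset.count_erase_self,
      Multiset.count_erase_self, count_eq_zero hred le_rfl] at this
    have := Multiset.count_pos.2 hpB
    omega

theorem decomposition_unique (h : IsReduction d red) {A B : Multiset M}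
    (hA : ∀ p ∈ A, Indecomposable p) (hB : ∀ p ∈ B, Indecomposable p) (hAB : A.prod = B.prod) :
    A = B := by
  classical
  induction hn : d A.prod using Nat.strong_induction_on generalizing A B with
  | _ n ih =>
    subst hn
    have hU (C D : Multiset M) (hC : ∀ p ∈ C, Indecomposable p) (hD : ∀ p ∈ D, Indecomposable p)
        (hCD : C.prod = D.prod) (hlt : d C.prod < d A.prod) : C = D := ih _ hlt hC hD hCD rfl
    by_contra hne
    let S := (A + B).toFinset.filter fun p => A.count p ≠ B.count p
    have hS {p : M} : p ∈ S ↔ A.count p ≠ B.count p := by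
      simp only [S, Finset.mem_filter, Multiset.mem_toFinset, ← Multiset.count_pos,
        Multiset.count_add]
      omega
    have hSne : S.Nonempty := by
      by_contra hS0
      refine hne (Multiset.ext.2 fun p => ?_)
      by_contra hp
      exact hS0 ⟨p, hS.2 hp⟩
    obtain ⟨p, hp, hmax⟩ := S.exists_max_image d hSne
    have hgt (q : M) (hq : d p < d q) : A.count q = B.count q := by
      by_contra hc
      have := hmax q (hS.2 hc)
      omega
    rcases lt_or_gt_of_ne (hS.1 hp) with hlt | hlt
    · exact h.false_of_count_lt hB hA hAB.symm (hAB ▸ hU) hlt fun q hq => (hgt q hq).symm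
    · exact h.false_of_count_lt hA hB hAB hU hlt hgt

theorem hasUniqueDecomposition (h : IsReduction d red) : HasUniqueDecomposition M := by
  intro x
  obtain ⟨A, hA, rfl⟩ := h.exists_decomposition x
  exact ⟨A, ⟨hA, rfl⟩, fun B hB => h.decomposition_unique hB.1 hA hB.2⟩

end IsReduction

/-! ### Laws of bisimilarity -/

namespace Bisim

variable [Infinite V]

theorem trans {P Q R : Proc V} (h₁ : Bisim P Q) (h₂ : Bisim Q R) : Bisim P R :=
  ((Struct.bisim h₁).trans (.bisim h₂)).toBisim

theorem par {P P' Q Q' : Proc V} (h₁ : Bisim P P') (h₂ : Bisim Q Q') :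
    Bisim (.par P Q) (.par P' Q') :=
  (((Struct.bisim h₁).par Q).trans ((Struct.bisim h₂).parRight P')).toBisim

theorem res {P Q : Proc V} (z : V) (h : Bisim P Q) :
    Bisim (.res (abs z P)) (.res (abs z Q)) :=
  ((Struct.bisim h).res z).toBisim

theorem par_comm (P Q : Proc V) : Bisim (.par P Q) (.par Q P) := (Struct.comm P Q).toBisim

theorem par_assoc (P Q R : Proc V) : Bisim (.par (.par P Q) R) (.par P (.par Q R)) :=
  (Struct.assoc P Q R).toBisim

theorem par_nil (P : Proc V) : Bisim (.par P nil) P := (Struct.parNil P).toBisim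

theorem extr_abs {z : V} (P : Proc V) {Q : Proc V} (h : z ∉ Q.fn) :
    Bisim (.par (.res (abs z P)) Q) (.res (abs z (.par P Q))) :=
  (Struct.extr_abs P h).toBisim

theorem extr_abs_right {z : V} {P : Proc V} (Q : Proc V) (h : z ∉ P.fn) :
    Bisim (.par P (.res (abs z Q))) (.res (abs z (.par P Q))) :=
  (Struct.extr_abs_right Q h).toBisim

end Bisim

theorem bisim_nil_of_forall_not_step {P : Proc V} (h : ∀ α P', ¬ Step P α P') : Bisim P nil :=
  ⟨fun P Q => (∀ α P', ¬ Step P α P') ∧ ∀ α Q', ¬ Step Q α Q',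
    ⟨fun _ _ h => h.symm, fun _ _ h _ _ _ hP => (h.1 _ _ hP).elim⟩, h, fun _ _ => not_step_nil⟩

/-! ### Depth -/

/-- `P` has an execution of length `n`. -/
def HasExec (n : ℕ) (P : Proc V) : Prop :=
  ∃ (ω : List (Act V)) (P' : Proc V), ω.length = n ∧ Exec P ω P'

theorem hasExec_zero (P : Proc V) : HasExec 0 P := ⟨[], P, rfl, .refl P⟩

theorem hasExec_succ {n : ℕ} {P : Proc V} :
    HasExec (n + 1) P ↔ ∃ α P', Step P α P' ∧ HasExec n P' := by
  constructor
  · rintro ⟨ω, P', hω, h⟩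
    cases h with
    | refl => simp at hω
    | step h₁ h₂ => exact ⟨_, _, h₁, _, _, by simpa using hω, h₂⟩
  · rintro ⟨α, P', h, ω, P'', hω, h'⟩
    exact ⟨α :: ω, P'', by simp [hω], .step h h'⟩

theorem isFinite_iff {P : Proc V} : IsFinite P ↔ ∃ n, ¬ HasExec (n + 1) P := Iff.rfl

namespace HasExec

theorem mono {m n : ℕ} {P : Proc V} (h : HasExec n P) (hmn : m ≤ n) : HasExec m P := by
  induction n generalizing m P with
  | zero => obtain rfl := Nat.le_zero.1 hmn; exact h
  | succ n ih =>
    cases m with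
    | zero => exact hasExec_zero P
    | succ m =>
      obtain ⟨α, P', hP, h⟩ := hasExec_succ.1 h
      exact hasExec_succ.2 ⟨α, P', hP, ih h (by omega)⟩

theorem map {n : ℕ} {P : Proc V} (h : HasExec n P) (σ : Equiv.Perm V) : HasExec n (P.map σ) := by
  induction n generalizing P with
  | zero => exact hasExec_zero _
  | succ n ih =>
    obtain ⟨α, P', hP, h⟩ := hasExec_succ.1 h
    exact hasExec_succ.2 ⟨_, _, hP.map σ, ih h⟩

variable [Infinite V]

/-- The first action of an execution can be chosen with a bound name outside any finite set. -/
theorem exists_fresh_step {n : ℕ} {P : Proc V} (h : HasExec (n + 1) P) {F : Set V}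
    (hF : F.Finite) : ∃ α P', Disjoint α.bn F ∧ Step P α P' ∧ HasExec n P' := by
  classical
  obtain ⟨α, P', hP, h⟩ := hasExec_succ.1 h
  cases α with
  | bout x z =>
    obtain ⟨w, hw⟩ := exists_fresh (hF.union P.finite_fn)
    simp only [Set.mem_union, not_or] at hw
    exact ⟨_, _, by simp [Act.bn, hw.1], hP.bout_swap hw.2, h.map _⟩
  | _ => exact ⟨_, _, by simp [Act.bn], hP, h⟩

theorem bisim {n : ℕ} {P Q : Proc V} (h : HasExec n P) (hPQ : Bisim P Q) :
    HasExec n Q := by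
  induction n generalizing P Q with
  | zero => exact hasExec_zero _
  | succ n ih =>
    obtain ⟨α, P', hα, hP, h⟩ := h.exists_fresh_step (P.finite_fn.union Q.finite_fn)
    obtain ⟨Q', hQ, h'⟩ := isBisimulation_bisim.2 _ _ hPQ α P' hα hP
    exact hasExec_succ.2 ⟨α, Q', hQ, ih h h'⟩

/-- Every transition of `νz.P` comes from one of `P`, so restriction does not increase the depth. -/
theorem inst_of_res {n : ℕ} {B : Proc (Option V)} (h : HasExec n (.res B)) {z : V}
    (hz : some z ∉ B.fn) : HasExec n (inst B z) := by
  classical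
  induction n generalizing B z with
  | zero => exact hasExec_zero _
  | succ n ih =>
    obtain ⟨α, T, hT, h⟩ := hasExec_succ.1 h
    obtain ⟨w, hw, hB⟩ : ∃ w, some w ∉ B.fn ∧ HasExec (n + 1) (inst B w) := by
      cases hT.resStep Set.finite_empty with
      | @res _ w P' hP _ _ hB =>
        have := ih h (z := w) (by simp [some_mem_fn_abs])
        rw [inst_abs_self] at this
        exact ⟨w, hB, hasExec_succ.2 ⟨_, _, hP, this⟩⟩
      | opn hP _ hB => exact ⟨_, hB, hasExec_succ.2 ⟨_, _, hP, h⟩⟩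
    rw [← inst_map_swap hw hz]
    exact hB.map _

theorem of_res_abs {n : ℕ} {z : V} {P : Proc V} (h : HasExec n (.res (abs z P))) :
    HasExec n P := by
  have := h.inst_of_res (z := z) (by simp [some_mem_fn_abs])
  rwa [inst_abs_self] at this

theorem par {m n : ℕ} {P Q : Proc V} (hP : HasExec m P) (hQ : HasExec n Q) :
    HasExec (m + n) (.par P Q) := by
  induction m generalizing P with
  | zero =>
    rw [Nat.zero_add]
    clear hP
    induction n generalizing Q with
    | zero => exact hasExec_zero _
    | succ n ih =>
      obtain ⟨α, Q', hα, hQ, h⟩ := hQ.exists_fresh_step P.finite_fn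
      exact hasExec_succ.2 ⟨_, _, .parR hQ hα, ih h⟩
  | succ m ih =>
    obtain ⟨α, P', hα, hP, h⟩ := hP.exists_fresh_step Q.finite_fn
    rw [Nat.succ_add]
    exact hasExec_succ.2 ⟨_, _, .parL hP hα, ih h⟩

/-- The actions of an execution of `P ∣ Q` are actions of executions of `P` and of `Q`, and a
communication combines two of them. -/
theorem of_par {n : ℕ} {P Q : Proc V} (h : HasExec n (.par P Q)) :
    ∃ k l, HasExec k P ∧ HasExec l Q ∧ n ≤ k + l := by
  induction n generalizing P Q with
  | zero => exact ⟨0, 0, hasExec_zero _, hasExec_zero _, le_rfl⟩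
  | succ n ih =>
    obtain ⟨α, T, hT, h⟩ := hasExec_succ.1 h
    have both {α β : Act V} {P' Q' : Proc V} (hP : Step P α P') (hQ : Step Q β Q')
        (h : HasExec n (.par P' Q')) : ∃ k l, HasExec k P ∧ HasExec l Q ∧ n + 1 ≤ k + l := by
      obtain ⟨k, l, hk, hl, hn⟩ := ih h
      exact ⟨k + 1, l + 1, hasExec_succ.2 ⟨_, _, hP, hk⟩, hasExec_succ.2 ⟨_, _, hQ, hl⟩,
        by omega⟩
    cases hT with
    | parL hP =>
      obtain ⟨k, l, hk, hl, hn⟩ := ih h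
      exact ⟨k + 1, l, hasExec_succ.2 ⟨_, _, hP, hk⟩, hl, by omega⟩
    | parR hQ =>
      obtain ⟨k, l, hk, hl, hn⟩ := ih h
      exact ⟨k, l + 1, hk, hasExec_succ.2 ⟨_, _, hQ, hl⟩, by omega⟩
    | commL hP hQ => exact both hP hQ h
    | commR hP hQ => exact both hP hQ h
    | closeL hP hQ => exact both hP hQ h.of_res_abs
    | closeR hP hQ => exact both hP hQ h.of_res_abs

end HasExec

/-- The greatest length of an execution of `P`, when `P` is finite. -/
noncomputable def depth (P : Proc V) : ℕ := sSup {n | HasExec n P}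

namespace IsFinite

theorem hasExec_iff {P : Proc V} (hP : IsFinite P) {n : ℕ} : HasExec n P ↔ n ≤ depth P := by
  obtain ⟨N, hN⟩ := isFinite_iff.1 hP
  have hb : BddAbove {n | HasExec n P} :=
    ⟨N, fun n hn => by
      by_contra! hlt
      exact hN (HasExec.mono hn hlt)⟩
  exact ⟨fun h => le_csSup hb h, fun h => (Nat.sSup_mem ⟨0, hasExec_zero P⟩ hb).mono h⟩

theorem of_forall_le {P : Proc V} {N : ℕ} (h : ∀ n, HasExec n P → n ≤ N) : IsFinite P :=
  isFinite_iff.2 ⟨N, fun hN => by have := h _ hN; omega⟩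

theorem hasExec_depth {P : Proc V} (hP : IsFinite P) : HasExec (depth P) P :=
  hP.hasExec_iff.2 le_rfl

theorem nil : IsFinite (nil : Proc V) :=
  isFinite_iff.2 ⟨0, fun h => by
    obtain ⟨_, _, h, _⟩ := hasExec_succ.1 h
    exact not_step_nil h⟩

theorem step {P P' : Proc V} {α : Act V} (hP : IsFinite P) (h : Step P α P') : IsFinite P' :=
  of_forall_le fun _ hn => Nat.le_of_succ_le (hP.hasExec_iff.1 (hasExec_succ.2 ⟨_, _, h, hn⟩))

theorem depth_lt_of_step {P P' : Proc V} {α : Act V} (hP : IsFinite P) (h : Step P α P') :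
    depth P' < depth P :=
  hP.hasExec_iff.1 (hasExec_succ.2 ⟨_, _, h, (hP.step h).hasExec_depth⟩)

theorem bisim_nil {P : Proc V} (hP : IsFinite P) (h : depth P = 0) : Bisim P PiCalc.nil :=
  bisim_nil_of_forall_not_step fun _ _ hs => by
    have := hP.depth_lt_of_step hs
    omega

variable [Infinite V]

theorem bisim {P Q : Proc V} (hP : IsFinite P) (h : Bisim P Q) : IsFinite Q :=
  of_forall_le fun _ hn => hP.hasExec_iff.1 (hn.bisim h.symm)

theorem res {P : Proc V} (hP : IsFinite P) (z : V) : IsFinite (.res (abs z P)) :=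
  of_forall_le fun _ hn => hP.hasExec_iff.1 hn.of_res_abs

theorem depth_res_le {P : Proc V} (hP : IsFinite P) (z : V) :
    depth (.res (abs z P)) ≤ depth P :=
  hP.hasExec_iff.1 (hP.res z).hasExec_depth.of_res_abs

theorem hasExec_par_le {P Q : Proc V} (hP : IsFinite P) (hQ : IsFinite Q) {n : ℕ}
    (h : HasExec n (.par P Q)) : n ≤ depth P + depth Q := by
  obtain ⟨k, l, hk, hl, hn⟩ := h.of_par
  exact hn.trans (Nat.add_le_add (hP.hasExec_iff.1 hk) (hQ.hasExec_iff.1 hl))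

theorem par {P Q : Proc V} (hP : IsFinite P) (hQ : IsFinite Q) : IsFinite (.par P Q) :=
  of_forall_le fun _ hn => hP.hasExec_par_le hQ hn

theorem depth_par {P Q : Proc V} (hP : IsFinite P) (hQ : IsFinite Q) :
    depth (.par P Q) = depth P + depth Q :=
  le_antisymm (hP.hasExec_par_le hQ (hP.par hQ).hasExec_depth)
    ((hP.par hQ).hasExec_iff.1 (hP.hasExec_depth.par hQ.hasExec_depth))

end IsFinite

theorem Bisim.depth_eq [Infinite V] {P Q : Proc V} (h : Bisim P Q) : depth P = depth Q := by
  unfold depth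
  congr 1
  ext n
  exact ⟨fun hn => hn.bisim h, fun hn => hn.bisim h.symm⟩

/-! ### Reduction of finite processes -/

/-- A transition without a bound name is a reduction if it decreases the depth by one, which
excludes communications; a bound output is a reduction to the process in which the extruded name is
restricted again. -/
inductive Red : Proc V → Proc V → Prop
  | free {P P' : Proc V} {α : Act V} (h : Step P α P') (hα : α.bn = ∅)
      (hd : depth P' + 1 = depth P) : Red P P'
  | bound {P P' : Proc V} {x z : V} (h : Step P (.bout x z) P') : Red P (.res (abs z P'))

namespace Red

theorem exists_of_depth_ne_zero {P : Proc V} (hP : IsFinite P) (h : depth P ≠ 0) :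
    ∃ P', Red P P' := by
  obtain ⟨n, hn⟩ := Nat.exists_eq_succ_of_ne_zero h
  obtain ⟨α, P', hs, h'⟩ := hasExec_succ.1 (hP.hasExec_iff.2 hn.ge : HasExec (n + 1) P)
  have h₁ := (hP.step hs).hasExec_iff.1 h'
  have h₂ := hP.depth_lt_of_step hs
  have hd : depth P' + 1 = depth P := by omega
  cases α with
  | bout x z => exact ⟨_, .bound hs⟩
  | _ => exact ⟨_, .free hs rfl hd⟩

variable [Infinite V]

theorem isFinite {P P' : Proc V} (h : Red P P') (hP : IsFinite P) : IsFinite P' := by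
  cases h with
  | free h => exact hP.step h
  | bound h => exact (hP.step h).res _

theorem depth_lt {P P' : Proc V} (h : Red P P') (hP : IsFinite P) : depth P' < depth P := by
  cases h with
  | free h => exact hP.depth_lt_of_step h
  | bound h => exact ((hP.step h).depth_res_le _).trans_lt (hP.depth_lt_of_step h)

/-- In a reduction by a bound output, the bound name can be chosen outside any finite set. -/
theorem cases_fresh {P R : Proc V} (h : Red P R) {F : Set V} (hF : F.Finite) :
    (∃ α, Step P α R ∧ α.bn = ∅ ∧ depth R + 1 = depth P) ∨
      ∃ x z P', z ∉ F ∧ Step P (.bout x z) P' ∧ R = .res (abs z P') := by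
  classical
  cases h with
  | free h hα hd => exact .inl ⟨_, h, hα, hd⟩
  | @bound P' x z h =>
    obtain ⟨w, hw⟩ := exists_fresh (hF.union (P.finite_fn.union P'.finite_fn))
    simp only [Set.mem_union, not_or] at hw
    exact .inr ⟨x, w, _, hw.1, h.bout_swap hw.2.1, by rw [abs_swap (.inr hw.2.2)]⟩

theorem bisim {P P' Q : Proc V} (h : Red P P') (hPQ : Bisim P Q) :
    ∃ Q', Red Q Q' ∧ Bisim P' Q' := by
  obtain ⟨α, hP, hα, hd⟩ | ⟨x, z, P', hz, hP, rfl⟩ :=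
    h.cases_fresh (P.finite_fn.union Q.finite_fn)
  · obtain ⟨Q', hQ, h'⟩ := isBisimulation_bisim.2 _ _ hPQ _ _ (by simp [hα]) hP
    exact ⟨Q', .free hQ hα (by rw [← h'.depth_eq, ← hPQ.depth_eq, hd]), h'⟩
  · obtain ⟨Q', hQ, h'⟩ := isBisimulation_bisim.2 _ _ hPQ _ _ (by simpa [Act.bn] using hz) hP
    exact ⟨_, .bound hQ, h'.res z⟩

theorem par {P P' Q : Proc V} (h : Red P P') (hP : IsFinite P) (hQ : IsFinite Q) :
    ∃ R, Red (.par P Q) R ∧ Bisim R (.par P' Q) := by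
  obtain ⟨α, hs, hα, hd⟩ | ⟨x, z, P', hz, hs, rfl⟩ := h.cases_fresh Q.finite_fn
  · refine ⟨_, .free (.parL hs (by simp [hα])) hα ?_, .refl _⟩
    rw [(hP.step hs).depth_par hQ, hP.depth_par hQ]
    omega
  · exact ⟨_, .bound (.parL hs (by simpa [Act.bn] using hz)), (Bisim.extr_abs _ hz).symm⟩

theorem of_par {P Q R : Proc V} (hR : Red (.par P Q) R) (hP : IsFinite P) (hQ : IsFinite Q) :
    (∃ P', Red P P' ∧ Bisim R (.par P' Q)) ∨ ∃ Q', Red Q Q' ∧ Bisim R (.par P Q') := by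
  have hPQ := hP.depth_par hQ
  obtain ⟨α, hs, hα, hd⟩ | ⟨x, z, P', hz, hs, rfl⟩ :=
    hR.cases_fresh (P.finite_fn.union Q.finite_fn)
  -- A communication decreases the depth of both components.
  · have lt {P' Q' : Proc V} {β γ : Act V} (h₁ : Step P β P') (h₂ : Step Q γ Q') :
        depth (P'.par Q') + 1 < depth (P.par Q) ∧
          ∀ z, depth (.res (abs z (P'.par Q'))) + 1 < depth (P.par Q) := by
      have := hP.depth_lt_of_step h₁
      have := hQ.depth_lt_of_step h₂
      have := (hP.step h₁).depth_par (hQ.step h₂)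
      have := ((hP.step h₁).par (hQ.step h₂)).depth_res_le
      exact ⟨by omega, fun z => by have := this z; omega⟩
    cases hs with
    | parL h =>
      rw [(hP.step h).depth_par hQ] at hd
      exact .inl ⟨_, .free h hα (by omega), .refl _⟩
    | parR h =>
      rw [hP.depth_par (hQ.step h)] at hd
      exact .inr ⟨_, .free h hα (by omega), .refl _⟩
    | commL h₁ h₂ => exact absurd hd (lt h₁ h₂).1.ne
    | commR h₁ h₂ => exact absurd hd (lt h₁ h₂).1.ne
    | closeL h₁ h₂ => exact absurd hd ((lt h₁ h₂).2 _).ne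
    | closeR h₁ h₂ => exact absurd hd ((lt h₁ h₂).2 _).ne
  · simp only [Set.mem_union, not_or] at hz
    cases hs with
    | parL h => exact .inl ⟨_, .bound h, (Bisim.extr_abs _ hz.2).symm⟩
    | parR h => exact .inr ⟨_, .bound h, (Bisim.extr_abs_right _ hz.1).symm⟩

end Red

/-! ### The commutative monoid of classes -/

theorem bisim_equivalence [Infinite V] : Equivalence (Bisim (V := V)) :=
  ⟨Bisim.refl, Bisim.symm, Bisim.trans⟩

theorem bisimClass_eq_iff [Infinite V] {P Q : Proc V} :
    bisimClass P = bisimClass Q ↔ Bisim P Q := by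
  constructor
  · intro h
    have : P ∈ bisimClass P := Bisim.refl P
    rwa [h] at this
  · intro h
    ext R
    exact ⟨fun hR => Bisim.trans hR h, fun hR => Bisim.trans hR h.symm⟩

namespace FinClass

/-- A finite process that represents a class. -/
noncomputable def rep (x : FinClass V) : Proc V := x.2.choose

theorem isFinite_rep (x : FinClass V) : IsFinite x.rep := x.2.choose_spec.1

theorem mk_rep (x : FinClass V) : mk x.rep x.isFinite_rep = x :=
  Subtype.ext x.2.choose_spec.2.symm

theorem exists_eq_mk (x : FinClass V) : ∃ P hP, x = mk P hP :=
  ⟨x.rep, x.isFinite_rep, x.mk_rep.symm⟩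

/-- The identity: the class of `0`. -/
noncomputable abbrev instOne : One (FinClass V) := ⟨mk nil .nil⟩

attribute [local instance] instOne

theorem one_def : (1 : FinClass V) = mk nil .nil := rfl

variable [Infinite V]

theorem mk_eq_mk_iff {P Q : Proc V} {hP : IsFinite P} {hQ : IsFinite Q} :
    mk P hP = mk Q hQ ↔ Bisim P Q :=
  Subtype.ext_iff.trans bisimClass_eq_iff

theorem bisim_rep_mk {P : Proc V} (hP : IsFinite P) : Bisim (mk P hP).rep P :=
  mk_eq_mk_iff.1 (mk_rep (mk P hP))

/-- The operation: the class of the parallel composition of representatives. -/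
noncomputable abbrev instMul : Mul (FinClass V) :=
  ⟨fun x y => mk (.par x.rep y.rep) (x.isFinite_rep.par y.isFinite_rep)⟩

attribute [local instance] instMul

theorem mk_mul_mk {P Q : Proc V} (hP : IsFinite P) (hQ : IsFinite Q) :
    mk P hP * mk Q hQ = mk (.par P Q) (hP.par hQ) :=
  mk_eq_mk_iff.2 ((bisim_rep_mk hP).par (bisim_rep_mk hQ))

theorem mul_comm' (x y : FinClass V) : x * y = y * x :=
  mk_eq_mk_iff.2 (.par_comm _ _)

theorem mul_one' (x : FinClass V) : x * 1 = x := by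
  obtain ⟨P, hP, rfl⟩ := x.exists_eq_mk
  rw [one_def, mk_mul_mk]
  exact mk_eq_mk_iff.2 (.par_nil P)

/-- The commutative monoid of classes of finite processes under parallel composition. -/
noncomputable abbrev commMonoid : CommMonoid (FinClass V) where
  mul_assoc x y z := by
    obtain ⟨P, hP, rfl⟩ := x.exists_eq_mk
    obtain ⟨Q, hQ, rfl⟩ := y.exists_eq_mk
    obtain ⟨R, hR, rfl⟩ := z.exists_eq_mk
    simp only [mk_mul_mk]
    exact mk_eq_mk_iff.2 (.par_assoc P Q R)
  mul_one := mul_one'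
  one_mul x := (mul_comm' _ _).trans (mul_one' x)
  mul_comm := mul_comm'

attribute [local instance] commMonoid

/-- The depth of a class is that of its representatives. -/
noncomputable def depth (x : FinClass V) : ℕ := PiCalc.depth x.rep

theorem depth_mk {P : Proc V} (hP : IsFinite P) : depth (mk P hP) = PiCalc.depth P :=
  (bisim_rep_mk hP).depth_eq

/-- Reduction of classes is reduction of representatives. -/
def Red (x y : FinClass V) : Prop :=
  ∃ P P' hP hP', PiCalc.Red P P' ∧ x = mk P hP ∧ y = mk P' hP'

theorem red_mk_iff {P : Proc V} {hP : IsFinite P} {y : FinClass V} :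
    Red (mk P hP) y ↔ ∃ P', ∃ h : PiCalc.Red P P', y = mk P' (h.isFinite hP) := by
  constructor
  · rintro ⟨Q, Q', hQ, hQ', h, he, rfl⟩
    obtain ⟨P', hP', hb⟩ := h.bisim (mk_eq_mk_iff.1 he).symm
    exact ⟨P', hP', mk_eq_mk_iff.2 hb⟩
  · rintro ⟨P', h, rfl⟩
    exact ⟨P, P', hP, _, h, rfl, rfl⟩

theorem isReduction : IsReduction (depth (V := V)) Red where
  depth_mul x y := by
    obtain ⟨P, hP, rfl⟩ := x.exists_eq_mk
    obtain ⟨Q, hQ, rfl⟩ := y.exists_eq_mk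
    simp only [mk_mul_mk, depth_mk, hP.depth_par hQ]
  eq_one {x} h := by
    obtain ⟨P, hP, rfl⟩ := x.exists_eq_mk
    rw [depth_mk] at h
    exact mk_eq_mk_iff.2 (hP.bisim_nil h)
  depth_lt := by
    rintro _ _ ⟨P, P', hP, hP', h, rfl, rfl⟩
    rw [depth_mk, depth_mk]
    exact h.depth_lt hP
  mul_right y h := by
    obtain ⟨P, P', hP, hP', h, rfl, rfl⟩ := h
    obtain ⟨Q, hQ, rfl⟩ := y.exists_eq_mk
    obtain ⟨R, hR, hb⟩ := h.par hP hQ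
    rw [mk_mul_mk, mk_mul_mk]
    exact red_mk_iff.2 ⟨R, hR, mk_eq_mk_iff.2 hb.symm⟩
  of_mul {x y w} h := by
    obtain ⟨P, hP, rfl⟩ := x.exists_eq_mk
    obtain ⟨Q, hQ, rfl⟩ := y.exists_eq_mk
    rw [mk_mul_mk] at h
    obtain ⟨R, hR, rfl⟩ := red_mk_iff.1 h
    obtain ⟨P', h', hb⟩ | ⟨Q', h', hb⟩ := hR.of_par hP hQ
    · refine .inl ⟨mk P' (h'.isFinite hP), red_mk_iff.2 ⟨P', h', rfl⟩, ?_⟩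
      rw [mk_mul_mk]
      exact mk_eq_mk_iff.2 hb
    · refine .inr ⟨mk Q' (h'.isFinite hQ), red_mk_iff.2 ⟨Q', h', rfl⟩, ?_⟩
      rw [mk_mul_mk]
      exact mk_eq_mk_iff.2 hb
  exists_red {x} h := by
    obtain ⟨P, hP, rfl⟩ := x.exists_eq_mk
    obtain ⟨P', h'⟩ := PiCalc.Red.exists_of_depth_ne_zero hP
      fun h0 => h (mk_eq_mk_iff.2 (hP.bisim_nil h0))
    exact ⟨_, red_mk_iff.2 ⟨P', h', rfl⟩⟩

theorem hasUniqueDecomposition : HasUniqueDecomposition (FinClass V) :=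
  isReduction.hasUniqueDecomposition

end FinClass

end PiCalc

theorem mainTheorem1 {V : Type*} [Infinite V] :
    Equivalence (PiCalc.Bisim (V := V)) ∧
    ∃ _inst : CommMonoid (PiCalc.FinClass V),
      (1 : PiCalc.FinClass V).val = PiCalc.bisimClass PiCalc.nil ∧
      (∀ (P Q : PiCalc.Proc V) (hP : PiCalc.IsFinite P) (hQ : PiCalc.IsFinite Q),
        (PiCalc.FinClass.mk P hP * PiCalc.FinClass.mk Q hQ).val =
          PiCalc.bisimClass (PiCalc.Term.par P Q)) ∧
      PiCalc.HasUniqueDecomposition (PiCalc.FinClass V) :=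
  ⟨PiCalc.bisim_equivalence, PiCalc.FinClass.commMonoid, rfl,
    fun _ _ hP hQ => congrArg Subtype.val (PiCalc.FinClass.mk_mul_mk hP hQ),
    PiCalc.FinClass.hasUniqueDecomposition⟩
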